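/- Let $M$ be a smooth (Hausdorff, finite-dimensional, real) manifold and $E\to M$ a smooth real vector bundle of finite rank. The gauge Lie algebroid $\mathfrak{D}E\to M$ has as fibre over $m$ the space of $\mathbb{R}$-linear operators $\mathfrak d:\Gamma(E)\to E_m$ together with a vector $x=\alpha(\mathfrak d)\in T_mM$, the anchor, such that $\mathfrak d(fu)=f(m)\,\mathfrak d(u)+x(f)\,u(m)$ for all $f\in C^\infty(M)$, $u\in\Gamma(E)$; its bracket $[\cdot,\cdot]_{\mathfrak D}$ on $\Gamma(\mathfrak{D}E)$ is the commutator of operators on $\Gamma(E)$, with anchor the commutator of the vector fields. Its standard $E$-dual (isomorphic to the first jet bundle of $E$) is $$\mathfrak{J}E=\{\nu\in\mathrm{Hom}(\mathfrak{D}E,E)\mid \nu(\Phi)=\Phi(\nu(\mathbf 1_E))\ \ \forall\,\Phi\in\mathfrak{gl}(E)\},$$ with the $E$-valued pairing $\langle\mu,\mathfrak d\rangle_E=\langle\mathfrak d,\mu\rangle_E=\mu(\mathfrak d)$. For $u\in\Gamma(E)$ let $\mathbb{d}u\in\Gamma(\mathfrak{J}E)$ be given by $\langle\mathbb{d}u,\mathfrak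 d\rangle_E=\mathfrak d u$, and for $\mathfrak d\in\Gamma(\mathfrak{D}E)$, $\mu\in\Gamma(\mathfrak{J}E)$ let $\mathfrak L_{\mathfrak d}\mu\in\Gamma(\mathfrak{J}E)$ be given by $\langle\mathfrak L_{\mathfrak d}\mu,\mathfrak d'\rangle_E=\mathfrak d\langle\mu,\mathfrak d'\rangle_E-\langle\mu,[\mathfrak d,\mathfrak d']_{\mathfrak D}\rangle_E$ for all $\mathfrak d'\in\Gamma(\mathfrak{D}E)$. The omni-Lie algebroid is $\mathcal E=\mathfrak{D}E\oplus\mathfrak{J}E$ with the projection $\rho:\mathcal E\to\mathfrak{D}E$, the symmetric $E$-valued form $$(\mathfrak d+\mu,\mathfrak r+\nu)_E=\tfrac12\big(\langle\mathfrak d,\nu\rangle_E+\langle\mathfrak r,\mu\rangle_E\big)$$ and the Dorfman bracket on $\Gamma(\mathcal E)$ $$\{\mathfrak d+\mu,\mathfrak r+\nu\}=[\mathfrak d,\mathfrak r]_{\mathfrak D}+\mathfrak L_{\mathfrak d}\nu-\mathfrak L_{\mathfrak r}\mu+\mathbb{d}\langle\mu,\mathfrak r\rangle_E .$$ A Dirac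 structure is a smooth subbundle $L\subset\mathcal E$ each of whose fibres $L_m$ is a maximal isotropic subspace of $\mathcal E_m$ for $(\cdot,\cdot)_E$, and whose space of smooth sections $\Gamma(L)$ is closed under $\{\cdot,\cdot\}$. **Proposition.** Let $L\subset\mathcal E$ be a Dirac structure. Then $L$, with the restriction of $\{\cdot,\cdot\}$ to $\Gamma(L)$ and the anchor $a=\alpha\circ\rho|_L:L\to TM$, is a Lie algebroid: the bracket is $\mathbb{R}$-bilinear, alternating and satisfies the Jacobi identity, $a$ is a smooth bundle map, $\{X,fY\}=f\{X,Y\}+a(X)(f)\,Y$ and $a\{X,Y\}=[a(X),a(Y)]$ for all $X,Y\in\Gamma(L)$, $f\in C^\infty(M)$. Moreover, $\rho|_L:L\to\mathfrak{D}E$ is a representation of $L$ on $E$, that is, a morphism of Lie algebroids over $\mathrm{id}_M$: a smooth bundle map with $\alpha\circ\rho|_L=a$ and $\rho\{X,Y\}=[\rho X,\rho Y]_{\mathfrak D}$ for all $X,Y\in\Gamma(L)$. -/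

import Mathlib

open Bundle Topology
open scoped Manifold ContDiff

noncomputable section

namespace OmniLie

/-- Smooth real-valued functions on `M`. -/
abbrev SmoothFun (n : ℕ) (M : Type*) [TopologicalSpace M]
    [ChartedSpace (EuclideanSpace ℝ (Fin n)) M] : Type _ := C^∞⟮𝓡 n, M; ℝ⟯

/-- Smooth vector fields on `M`. -/
abbrev VecField (n : ℕ) (M : Type*) [TopologicalSpace M]
    [ChartedSpace (EuclideanSpace ℝ (Fin n)) M] [IsManifold (𝓡 n) ∞ M] : Type _ :=
  Cₛ^∞⟮𝓡 n; EuclideanSpace ℝ (Fin n), (TangentSpace (𝓡 n) : M → Type _)⟯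

/-- The space `Γ(E)` of smooth global sections of a vector bundle `E → M` with model fibre `F`. -/
abbrev Sec (n : ℕ) {M : Type*} [TopologicalSpace M] [ChartedSpace (EuclideanSpace ℝ (Fin n)) M]
    (F : Type*) [NormedAddCommGroup F] [NormedSpace ℝ F] (E : M → Type*)
    [TopologicalSpace (TotalSpace F E)] [∀ m, AddCommGroup (E m)] [∀ m, Module ℝ (E m)]
    [∀ m, TopologicalSpace (E m)] [FiberBundle F E] [VectorBundle ℝ F E] : Type _ :=
  Cₛ^∞⟮𝓡 n; F, E⟯

section Basic

variable {n : ℕ} {M : Type*} [TopologicalSpace M] [ChartedSpace (EuclideanSpace ℝ (Fin n)) M]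

/-- The derivative `x(f)` of a smooth function along a tangent vector `x ∈ T_m M`. -/
def dirDeriv {m : M} (x : TangentSpace (𝓡 n) m) (f : SmoothFun n M) : ℝ :=
  mvfderiv (𝓡 n) f m x

lemma dirDeriv_add_left {m : M} (x y : TangentSpace (𝓡 n) m) (f : SmoothFun n M) :
    dirDeriv (x + y) f = dirDeriv x f + dirDeriv y f := map_add _ _ _

lemma dirDeriv_smul_left {m : M} (c : ℝ) (x : TangentSpace (𝓡 n) m) (f : SmoothFun n M) :
    dirDeriv (c • x) f = c * dirDeriv x f := map_smul _ _ _

lemma dirDeriv_zero_left {m : M} (f : SmoothFun n M) :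
    dirDeriv (0 : TangentSpace (𝓡 n) m) f = 0 := map_zero _

lemma SmoothFun.mdiff (f : SmoothFun n M) (m : M) :
    MDifferentiableAt (𝓡 n) 𝓘(ℝ, ℝ) f m := f.contMDiff.mdifferentiable (by simp) m

lemma dirDeriv_add {m : M} (x : TangentSpace (𝓡 n) m) (f g : SmoothFun n M) :
    dirDeriv x (f + g) = dirDeriv x f + dirDeriv x g := by
  simp [dirDeriv, ContMDiffMap.coe_add, mvfderiv_add (f.mdiff m) (g.mdiff m)]

lemma dirDeriv_const_smul {m : M} (x : TangentSpace (𝓡 n) m) (c : ℝ) (f : SmoothFun n M) :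
    dirDeriv x (c • f) = c * dirDeriv x f := by
  have h : (⇑(c • f) : M → ℝ) = (fun _ => c) * ⇑f := by ext p; simp
  have := mvfderiv_mul (I := 𝓡 n) (mdifferentiableAt_const (c := c) (x := m)) (f.mdiff m)
  simp [dirDeriv, h, this, mvfderiv_const]

lemma dirDeriv_mul {m : M} (x : TangentSpace (𝓡 n) m) (f g : SmoothFun n M) :
    dirDeriv x (f * g) = f m * dirDeriv x g + g m * dirDeriv x f := by
  have := mvfderiv_mul (I := 𝓡 n) (f.mdiff m) (g.mdiff m)
  simp [dirDeriv, this]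

lemma dirDeriv_one {m : M} (x : TangentSpace (𝓡 n) m) :
    dirDeriv x (1 : SmoothFun n M) = 0 := by
  have := dirDeriv_mul x (1 : SmoothFun n M) 1
  simp only [mul_one, ContMDiffMap.coe_one, Pi.one_apply, one_mul] at this
  linarith

lemma dirDeriv_sum_left {ι : Type*} (t : Finset ι) {m : M} (x : ι → TangentSpace (𝓡 n) m)
    (f : SmoothFun n M) : dirDeriv (∑ i ∈ t, x i) f = ∑ i ∈ t, dirDeriv (x i) f :=
  map_sum (mvfderiv (𝓡 n) f m) _ _

lemma dirDeriv_congr {m : M} (x : TangentSpace (𝓡 n) m) {f g : SmoothFun n M}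
    (h : ∀ᶠ p in 𝓝 m, f p = g p) : dirDeriv x f = dirDeriv x g := by
  have : (f : M → ℝ) =ᶠ[𝓝 m] g := h
  simp only [dirDeriv, mvfderiv, this.mfderiv_eq]
  rfl

/-- The function `x(f)` for a smooth vector field `x`. -/
def VecField.app [IsManifold (𝓡 n) ∞ M] (x : VecField n M) (f : SmoothFun n M) :
    SmoothFun n M where
  val p := dirDeriv (x p) f
  property := by
    have h1 := f.contMDiff.contMDiff_tangentMap (m := ∞) (by simp)
    have h2 := (contMDiff_snd_tangentBundle_modelSpace ℝ 𝓘(ℝ, ℝ) (n := ∞)).comp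
      (h1.comp x.contMDiff)
    exact h2

@[simp] lemma VecField.app_apply [IsManifold (𝓡 n) ∞ M] (x : VecField n M) (f : SmoothFun n M)
    (p : M) : x.app f p = dirDeriv (x p) f := rfl

/-- The commutator of smooth vector fields. -/
def VecField.bracket [IsManifold (𝓡 n) ∞ M] (x y : VecField n M) : VecField n M where
  toFun := VectorField.mlieBracket (𝓡 n) x y
  contMDiff_toFun := by
    have : IsManifold (𝓡 n) (minSmoothness ℝ 2) M := by
      rw [minSmoothness_of_isRCLikeNormedField]; infer_instance
    have : IsManifold (𝓡 n) (((⊤ : ℕ∞) : WithTop ℕ∞) + 1) M := by simpa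
    exact ContDiff.mlieBracket_vectorField (m := ⊤) (n := ⊤)
      x.contMDiff y.contMDiff (by simp)

variable {F : Type*} [NormedAddCommGroup F] [NormedSpace ℝ F] {E : M → Type*}
    [TopologicalSpace (TotalSpace F E)] [∀ m, AddCommGroup (E m)] [∀ m, Module ℝ (E m)]
    [∀ m, TopologicalSpace (E m)] [FiberBundle F E] [VectorBundle ℝ F E]

/-- The product `f u` of a smooth function and a smooth section. -/
def fsmul (f : SmoothFun n M) (u : Sec n F E) : Sec n F E where
  toFun p := f p • u p
  contMDiff_toFun := f.contMDiff.smul_section u.contMDiff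

@[simp] lemma fsmul_apply (f : SmoothFun n M) (u : Sec n F E) (p : M) :
    fsmul f u p = f p • u p := rfl

lemma sec_sum_apply {ι : Type*} (t : Finset ι) (g : ι → Sec n F E) (p : M) :
    (∑ i ∈ t, g i) p = ∑ i ∈ t, g i p := by
  have := map_sum (ContMDiffSection.coeAddHom (𝓡 n) F ∞ E) g t
  exact (congrFun this p).trans (Finset.sum_apply _ _ _)

variable [ContMDiffVectorBundle ∞ F E (𝓡 n)]

lemma exists_localFrame [FiniteDimensional ℝ F] [T2Space M] [IsManifold (𝓡 n) ∞ M] (m : M) :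
    ∃ (k : ℕ) (s : Fin k → Sec n F E) (c : Fin k → Sec n F E →ₗ[ℝ] SmoothFun n M)
      (ψ : SmoothFun n M), (∀ᶠ p in 𝓝 m, ψ p = 1) ∧
      (∀ j f u, c j (fsmul f u) = f * c j u) ∧ (∀ j u p, u p = 0 → c j u p = 0) ∧
      (∀ u, ∑ j, fsmul (c j u) (s j) = fsmul ψ u) := by
  let e := trivializationAt F E m
  have hm : e.baseSet ∈ 𝓝 m :=
    e.open_baseSet.mem_nhds (FiberBundle.mem_baseSet_trivializationAt F E m)
  obtain ⟨χ, -, hχ⟩ := (SmoothBumpFunction.nhds_basis_tsupport (I := 𝓡 n) m).mem_iff.1 hm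
  let b := Module.finBasis ℝ F
  have : ContMDiffVectorBundle 1 F E (𝓡 n) := ContMDiffVectorBundle.of_le (n := ∞) (by simp)
  let s : Fin (Module.finrank ℝ F) → Sec n F E := fun j =>
    ⟨(χ : M → ℝ) • e.localFrame b j, ContMDiffOn.smul_section_of_tsupport
      χ.contMDiff.contMDiffOn e.open_baseSet hχ (e.contMDiffOn_localFrame_baseSet _ b j)⟩
  have hc : ∀ (j) (u : Sec n F E), ContMDiff (𝓡 n) 𝓘(ℝ, ℝ) ∞
      (fun p => χ p * e.localFrameCoeff (𝓡 n) b j p (u p)) := by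
    intro j u
    refine contMDiff_of_tsupport fun p hp => ?_
    have hp' : p ∈ e.baseSet := hχ (tsupport_mul_subset_left hp)
    exact χ.contMDiff.contMDiffAt.mul
      (contMDiffAt_localFrameCoeff b hp' u.contMDiff.contMDiffAt j)
  let c : Fin (Module.finrank ℝ F) → Sec n F E →ₗ[ℝ] SmoothFun n M := fun j =>
    { toFun := fun u => ⟨fun p => χ p * e.localFrameCoeff (𝓡 n) b j p (u p), hc j u⟩
      map_add' := fun u v => by
        ext p
        change χ p * e.localFrameCoeff (𝓡 n) b j p (u p + v p) = _ * _ + _ * _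
        rw [map_add, mul_add]
      map_smul' := fun r u => by
        ext p
        change χ p * e.localFrameCoeff (𝓡 n) b j p (r • u p) = r * (_ * _)
        rw [map_smul, smul_eq_mul]; ring }
  refine ⟨_, s, c, ⟨fun p => χ p * χ p, χ.contMDiff.mul χ.contMDiff⟩, ?_, ?_, ?_, ?_⟩
  · filter_upwards [χ.eventuallyEq_one] with p hp
    simp [hp]
  · intro j f u
    ext p
    change χ p * e.localFrameCoeff (𝓡 n) b j p (f p • u p) = f p * (_ * _)
    rw [map_smul, smul_eq_mul]; ring
  · intro j u p hu
    change χ p * e.localFrameCoeff (𝓡 n) b j p (u p) = 0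
    rw [hu, map_zero, mul_zero]
  · intro u
    ext p
    rw [sec_sum_apply]
    change ∑ j, (χ p * e.localFrameCoeff (𝓡 n) b j p (u p)) • (χ p • e.localFrame b j p)
      = (χ p * χ p) • u p
    by_cases hp : p ∈ e.baseSet
    · conv_rhs => rw [e.eq_sum_localFrameCoeff_smul (s := u) (I := 𝓡 n) (b := b) hp]
      rw [Finset.smul_sum]
      refine Finset.sum_congr rfl fun j _ => ?_
      simp only [smul_smul]
      congr 1
      ring
    · have : χ p = 0 := image_eq_zero_of_notMem_tsupport fun h => hp (hχ h)
      simp [this]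

lemma exists_section_apply_eq [FiniteDimensional ℝ F] [T2Space M] [IsManifold (𝓡 n) ∞ M]
    (m : M) (v : E m) : ∃ u : Sec n F E, u m = v := by
  obtain ⟨t, ht, hs⟩ := FiberBundle.exists_contMDiffOn_extend (𝓡 n) (k := ∞) F v
  obtain ⟨χ, -, hχ⟩ :=
    (SmoothBumpFunction.nhds_basis_tsupport (I := 𝓡 n) m).mem_iff.1 (interior_mem_nhds.2 ht)
  refine ⟨⟨(χ : M → ℝ) • FiberBundle.extend F v, ContMDiffOn.smul_section_of_tsupport
      χ.contMDiff.contMDiffOn isOpen_interior hχ (hs.mono interior_subset)⟩, ?_⟩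
  change χ m • FiberBundle.extend F v m = v
  simp

lemma VecField.mdiff [IsManifold (𝓡 n) ∞ M] (z : VecField n M) (p : M) :
    MDifferentiableAt (𝓡 n) (𝓡 n).tangent (fun p => (⟨p, z p⟩ : TangentBundle (𝓡 n) M)) p :=
  z.contMDiff.mdifferentiable (by simp) p

lemma VecField.bracket_fsmul [IsManifold (𝓡 n) ∞ M] (u v : VecField n M) (g : SmoothFun n M) :
    u.bracket (fsmul g v) = fsmul (u.app g) v + fsmul g (u.bracket v) := by
  ext p
  exact VectorField.mlieBracket_smul_right (g.mdiff p) (v.mdiff p)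

lemma VecField.bracket_add [IsManifold (𝓡 n) ∞ M] (u v w : VecField n M) :
    u.bracket (v + w) = u.bracket v + u.bracket w := by
  have : IsManifold (𝓡 n) (minSmoothness ℝ 2) M := by
    rw [minSmoothness_of_isRCLikeNormedField]; infer_instance
  ext p
  exact VectorField.mlieBracket_add_right (v.mdiff p) (w.mdiff p)

lemma VecField.bracket_const_smul [IsManifold (𝓡 n) ∞ M] (u v : VecField n M) (r : ℝ) :
    u.bracket (r • v) = r • u.bracket v := by
  have : IsManifold (𝓡 n) (minSmoothness ℝ 2) M := by
    rw [minSmoothness_of_isRCLikeNormedField]; infer_instance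
  ext p
  exact VectorField.mlieBracket_const_smul_right (v.mdiff p)

lemma VecField.bracket_zero [IsManifold (𝓡 n) ∞ M] (u : VecField n M) :
    u.bracket 0 = 0 := by
  have h := VecField.bracket_const_smul u 0 (0 : ℝ)
  rwa [zero_smul, zero_smul] at h

/-- The commutator of vector fields is the commutator of derivations. -/
lemma dirDeriv_bracket [T2Space M] [IsManifold (𝓡 n) ∞ M] (x y : VecField n M) (f : SmoothFun n M) (m : M) :
    dirDeriv (x.bracket y m) f = dirDeriv (x m) (y.app f) - dirDeriv (y m) (x.app f) := by
  have : IsManifold (𝓡 n) (minSmoothness ℝ 3) M := by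
    rw [minSmoothness_of_isRCLikeNormedField]; infer_instance
  have : IsManifold (𝓡 n) (minSmoothness ℝ 2) M := by
    rw [minSmoothness_of_isRCLikeNormedField]; infer_instance
  have cd : ∀ z : VecField n M, ContMDiff (𝓡 n) (𝓡 n).tangent (minSmoothness ℝ 2)
      (fun p => (⟨p, z p⟩ : TangentBundle (𝓡 n) M)) := fun z => by
    rw [minSmoothness_of_isRCLikeNormedField]; exact z.contMDiff.of_le ENat.LEInfty.out
  have L := fun (u v : VecField n M) (g : SmoothFun n M) => VecField.bracket_fsmul u v g
  have J : ∀ u v w : VecField n M,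
      u.bracket (v.bracket w) = (u.bracket v).bracket w + v.bracket (u.bracket w) := by
    intro u v w
    ext p
    exact VectorField.leibniz_identity_mlieBracket_apply (cd u p) (cd v p) (cd w p)
  have A := fun u v w : VecField n M => VecField.bracket_add u v w
  by_cases hs : Subsingleton (TangentSpace (𝓡 n) m)
  · rw [Subsingleton.elim (x.bracket y m) 0, Subsingleton.elim (x m) 0, Subsingleton.elim (y m) 0]
    simp [dirDeriv_zero_left]
  rw [not_subsingleton_iff_nontrivial] at hs
  obtain ⟨v, hv⟩ := exists_ne (0 : TangentSpace (𝓡 n) m)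
  obtain ⟨z, hz⟩ := exists_section_apply_eq (n := n) (F := EuclideanSpace ℝ (Fin n)) m v
  have key := congrArg (fun u : VecField n M => u m) (J x y (fsmul f z))
  simp only [L, A] at key
  have key2 := congrArg (fun u : VecField n M => u m) (J x y z)
  simp only [ContMDiffSection.coe_add, Pi.add_apply, fsmul_apply, VecField.app_apply] at key key2
  rw [key2] at key
  have : (dirDeriv (x m) (y.app f) - dirDeriv (y m) (x.app f) - dirDeriv (x.bracket y m) f) • z m
      = 0 := by
    simp only [sub_smul]
    rw [← sub_eq_zero.2 key]
    module
  rw [hz] at this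
  have := (smul_eq_zero.1 this).resolve_right hv
  linarith

end Basic

section Gauge

variable (n : ℕ) {M : Type*} [TopologicalSpace M] [ChartedSpace (EuclideanSpace ℝ (Fin n)) M]
    (F : Type*) [NormedAddCommGroup F] [NormedSpace ℝ F] (E : M → Type*)
    [TopologicalSpace (TotalSpace F E)] [∀ m, AddCommGroup (E m)] [∀ m, Module ℝ (E m)]
    [∀ m, TopologicalSpace (E m)] [FiberBundle F E] [VectorBundle ℝ F E]

/-- Pairs of an `ℝ`-linear operator `δ : Γ(E) → E_m` and a tangent vector `x ∈ T_m M` with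
`δ (f u) = f(m) δ(u) + x(f) u(m)`. -/
def gaugeSubmodule (m : M) : Submodule ℝ ((Sec n F E →ₗ[ℝ] E m) × TangentSpace (𝓡 n) m) where
  carrier := {d | ∀ (f : SmoothFun n M) (u : Sec n F E),
    d.1 (fsmul f u) = f m • d.1 u + dirDeriv d.2 f • u m}
  zero_mem' f u := by simp [dirDeriv_zero_left]
  add_mem' {a b} ha hb f u := by
    simp only [Set.mem_ofPred_eq] at ha hb
    simp only [Prod.fst_add, Prod.snd_add, LinearMap.add_apply, ha f u, hb f u, dirDeriv_add_left]
    module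
  smul_mem' r a ha f u := by
    simp only [Set.mem_ofPred_eq] at ha
    simp only [Prod.smul_fst, Prod.smul_snd, LinearMap.smul_apply, ha f u, dirDeriv_smul_left]
    module

/-- The fibre `(𝔇E)_m` of the gauge Lie algebroid (the bundle of covariant differential operators)
of `E`: operators `𝔡 : Γ(E) → E_m` together with their anchor `x ∈ T_m M`. -/
def GaugeFiber (m : M) : Type _ := gaugeSubmodule n F E m

instance instAddCommGroupGaugeFiber (m : M) : AddCommGroup (GaugeFiber n F E m) :=
  (gaugeSubmodule n F E m).addCommGroup

instance instModuleGaugeFiber (m : M) : Module ℝ (GaugeFiber n F E m) :=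
  (gaugeSubmodule n F E m).module

variable {n F E}

/-- The value `𝔡 u ∈ E_m` of `𝔡 ∈ (𝔇E)_m` on a section `u`. -/
def gaugeAct {m : M} (d : GaugeFiber n F E m) : Sec n F E →ₗ[ℝ] E m := d.1.1

/-- The anchor `α : 𝔇E → TM` of the gauge Lie algebroid. -/
def gaugeAnchor (m : M) : GaugeFiber n F E m →ₗ[ℝ] TangentSpace (𝓡 n) m :=
  (LinearMap.snd ℝ _ _).comp (gaugeSubmodule n F E m).subtype

@[simp] lemma gaugeAct_zero {m : M} (u : Sec n F E) :
    gaugeAct (0 : GaugeFiber n F E m) u = 0 := rfl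

@[simp] lemma gaugeAct_add {m : M} (d d' : GaugeFiber n F E m) (u : Sec n F E) :
    gaugeAct (d + d') u = gaugeAct d u + gaugeAct d' u := rfl

@[simp] lemma gaugeAct_smul {m : M} (r : ℝ) (d : GaugeFiber n F E m) (u : Sec n F E) :
    gaugeAct (r • d) u = r • gaugeAct d u := rfl

lemma gaugeAct_fsmul {m : M} (d : GaugeFiber n F E m) (f : SmoothFun n M) (u : Sec n F E) :
    gaugeAct d (fsmul f u) = f m • gaugeAct d u + dirDeriv (gaugeAnchor m d) f • u m := d.2 f u

lemma gauge_ext {m : M} {d d' : GaugeFiber n F E m} (h : ∀ u, gaugeAct d u = gaugeAct d' u)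
    (h' : gaugeAnchor m d = gaugeAnchor m d') : d = d' :=
  Subtype.ext (Prod.ext (LinearMap.ext h) h')

/-- The inclusion `𝔤𝔩(E_m) → (𝔇E)_m`, `Φ ↦ (u ↦ Φ (u(m)))`, with anchor zero. -/
def glIncl (m : M) (Φ : E m →ₗ[ℝ] E m) : GaugeFiber n F E m :=
  ⟨({ toFun := fun u => Φ (u m)
      map_add' := fun u v => map_add Φ (u m) (v m)
      map_smul' := fun r u => map_smul Φ r (u m) }, 0), fun f u => by
    simp [dirDeriv_zero_left]⟩

@[simp] lemma gaugeAct_glIncl (m : M) (Φ : E m →ₗ[ℝ] E m) (u : Sec n F E) :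
    gaugeAct (glIncl m Φ) u = Φ (u m) := rfl

@[simp] lemma gaugeAnchor_glIncl (m : M) (Φ : E m →ₗ[ℝ] E m) :
    gaugeAnchor m (glIncl m Φ : GaugeFiber n F E m) = 0 := rfl

variable (n F E)

/-- Linear maps `ν : (𝔇E)_m → E_m` with `ν(Φ) = Φ(ν(1))` for all `Φ ∈ 𝔤𝔩(E_m)`. -/
def jetSubmodule (m : M) : Submodule ℝ (GaugeFiber n F E m →ₗ[ℝ] E m) where
  carrier := {ν | ∀ Φ : E m →ₗ[ℝ] E m, ν (glIncl m Φ) = Φ (ν (glIncl m LinearMap.id))}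
  zero_mem' Φ := by simp
  add_mem' {a b} ha hb Φ := by
    simp only [Set.mem_ofPred_eq] at ha hb
    simp [ha Φ, hb Φ]
  smul_mem' r a ha Φ := by
    simp only [Set.mem_ofPred_eq] at ha
    simp [ha Φ]

/-- The fibre `(𝔍E)_m` of the standard `E`-dual bundle `𝔍E` of `𝔇E`, which is canonically
isomorphic to the first jet bundle of `E`. -/
def JetFiber (m : M) : Type _ := jetSubmodule n F E m

instance instAddCommGroupJetFiber (m : M) : AddCommGroup (JetFiber n F E m) :=
  (jetSubmodule n F E m).addCommGroup

instance instModuleJetFiber (m : M) : Module ℝ (JetFiber n F E m) :=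
  (jetSubmodule n F E m).module

variable {n F E} in
/-- The fibrewise pairing `⟨μ, 𝔡⟩_E = μ(𝔡)`, as a bilinear map. -/
def fiberPairing (m : M) : JetFiber n F E m →ₗ[ℝ] GaugeFiber n F E m →ₗ[ℝ] E m :=
  (jetSubmodule n F E m).subtype

variable {n F E} in
lemma fiberPairing_glIncl (m : M) (μ : JetFiber n F E m) (Φ : E m →ₗ[ℝ] E m) :
    fiberPairing m μ (glIncl m Φ) = Φ (fiberPairing m μ (glIncl m LinearMap.id)) := μ.2 Φ

variable {n F E}

variable [IsManifold (𝓡 n) ∞ M]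

/-- Smoothness of a (set-theoretic) section of `E`. -/
def IsSmoothSec (s : ∀ m, E m) : Prop :=
  ContMDiff (𝓡 n) ((𝓡 n).prod 𝓘(ℝ, F)) ∞ fun m => (⟨m, s m⟩ : TotalSpace F E)

variable (n F E)

/-- `Γ(𝔇E)`: the sections `D` of the gauge algebroid such that the anchor of `D` is a smooth
vector field and `m ↦ D_m u` is a smooth section of `E` for every smooth section `u`. -/
def gaugeSections : Submodule ℝ (∀ m : M, GaugeFiber n F E m) where
  carrier := {D | IsSmoothSec (n := n) (F := EuclideanSpace ℝ (Fin n))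
      (E := (TangentSpace (𝓡 n) : M → Type _)) (fun m => gaugeAnchor m (D m)) ∧
    ∀ u : Sec n F E, IsSmoothSec (n := n) (F := F) fun m => gaugeAct (D m) u}
  zero_mem' := ⟨(0 : VecField n M).contMDiff, fun _ => (0 : Sec n F E).contMDiff⟩
  add_mem' ha hb := ⟨ha.1.add_section hb.1, fun u => (ha.2 u).add_section (hb.2 u)⟩
  smul_mem' _ _ ha := ⟨ha.1.const_smul_section, fun u => (ha.2 u).const_smul_section⟩

variable {n F E}

/-- The smooth vector field underlying a section of `𝔇E`. -/
def gaugeField (D : gaugeSections n F E) : VecField n M :=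
  ⟨fun m => gaugeAnchor m (D.1 m), D.2.1⟩

/-- The operator `Γ(E) → Γ(E)` given by a section of `𝔇E`. -/
def gaugeOp (D : gaugeSections n F E) : Sec n F E →ₗ[ℝ] Sec n F E where
  toFun u := ⟨fun m => gaugeAct (D.1 m) u, D.2.2 u⟩
  map_add' u v := by ext m; exact map_add (gaugeAct (D.1 m)) u v
  map_smul' r u := by ext m; exact map_smul (gaugeAct (D.1 m)) r u

@[simp] lemma gaugeOp_apply (D : gaugeSections n F E) (u : Sec n F E) (m : M) :
    gaugeOp D u m = gaugeAct (D.1 m) u := rfl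

@[simp] lemma gaugeField_apply (D : gaugeSections n F E) (m : M) :
    gaugeField D m = gaugeAnchor m (D.1 m) := rfl

lemma gaugeOp_fsmul (D : gaugeSections n F E) (f : SmoothFun n M) (u : Sec n F E) :
    gaugeOp D (fsmul f u) = fsmul f (gaugeOp D u) + fsmul ((gaugeField D).app f) u := by
  ext m; exact gaugeAct_fsmul (D.1 m) f u

/-- A derivative endomorphism of `Γ(E)` (an operator satisfying the Leibniz rule over a vector
field) as a section of `𝔇E`. -/
def mkGauge (T : Sec n F E →ₗ[ℝ] Sec n F E) (x : VecField n M)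
    (h : ∀ f u, T (fsmul f u) = fsmul f (T u) + fsmul (x.app f) u) : gaugeSections n F E :=
  ⟨fun m => ⟨({ toFun := fun u => T u m
                map_add' := fun u v => by rw [map_add]; rfl
                map_smul' := fun r u => by rw [map_smul]; rfl }, x m),
      fun f u => by
        change T (fsmul f u) m = _
        rw [h]; rfl⟩,
    x.contMDiff, fun u => (T u).contMDiff⟩

@[simp] lemma gaugeAct_mkGauge (T : Sec n F E →ₗ[ℝ] Sec n F E) (x : VecField n M)
    (h : ∀ f u, T (fsmul f u) = fsmul f (T u) + fsmul (x.app f) u) (m : M) (u : Sec n F E) :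
    gaugeAct ((mkGauge T x h).1 m) u = T u m := rfl

@[simp] lemma gaugeAnchor_mkGauge (T : Sec n F E →ₗ[ℝ] Sec n F E) (x : VecField n M)
    (h : ∀ f u, T (fsmul f u) = fsmul f (T u) + fsmul (x.app f) u) (m : M) :
    gaugeAnchor m ((mkGauge T x h).1 m) = x m := rfl

lemma gaugeSec_ext {D D' : gaugeSections n F E} (h : ∀ m u, gaugeAct (D.1 m) u = gaugeAct (D'.1 m) u)
    (h' : ∀ m, gaugeAnchor m (D.1 m) = gaugeAnchor m (D'.1 m)) : D = D' :=
  Subtype.ext (funext fun m => gauge_ext (h m) (h' m))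

/-- The product `f D` of a smooth function and a section of `𝔇E`. -/
def gaugeSmul (f : SmoothFun n M) (D : gaugeSections n F E) : gaugeSections n F E :=
  ⟨fun m => f m • D.1 m, f.contMDiff.smul_section D.2.1,
    fun u => f.contMDiff.smul_section (D.2.2 u)⟩

@[simp] lemma gaugeSmul_apply (f : SmoothFun n M) (D : gaugeSections n F E) (m : M) :
    (gaugeSmul f D).1 m = f m • D.1 m := rfl

/-- The commutator of derivative endomorphisms, with anchor the commutator of the anchors. -/
def gaugeBracket [T2Space M] (D R : gaugeSections n F E) : gaugeSections n F E :=
  mkGauge (gaugeOp D ∘ₗ gaugeOp R - gaugeOp R ∘ₗ gaugeOp D)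
    ((gaugeField D).bracket (gaugeField R)) fun f u => by
      ext m
      simp only [LinearMap.sub_apply, LinearMap.comp_apply, gaugeOp_fsmul, map_add,
        ContMDiffSection.coe_sub, ContMDiffSection.coe_add, Pi.sub_apply, Pi.add_apply,
        fsmul_apply, VecField.app_apply, dirDeriv_bracket]
      module

lemma gaugeBracket_smul_right [T2Space M] (D R : gaugeSections n F E) (f : SmoothFun n M) :
    gaugeBracket D (gaugeSmul f R) =
      gaugeSmul f (gaugeBracket D R) + gaugeSmul ((gaugeField D).app f) R := by
  have h : ∀ u, gaugeOp (gaugeSmul f R) u = fsmul f (gaugeOp R u) := fun _ => rfl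
  refine gaugeSec_ext (fun m u => ?_) fun m => ?_
  · change (gaugeOp D (gaugeOp (gaugeSmul f R) u) - gaugeOp (gaugeSmul f R) (gaugeOp D u)) m =
      f m • (gaugeOp D (gaugeOp R u) - gaugeOp R (gaugeOp D u)) m +
        (gaugeField D).app f m • gaugeOp R u m
    rw [h, h, gaugeOp_fsmul]
    simp only [ContMDiffSection.coe_sub, ContMDiffSection.coe_add, Pi.sub_apply, Pi.add_apply,
      fsmul_apply]
    module
  · have := congrArg (fun v : VecField n M => v m)
      (VecField.bracket_fsmul (gaugeField D) (gaugeField R) f)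
    exact this.trans (add_comm _ _)

lemma gaugeBracket_const_smul_right [T2Space M] (D R : gaugeSections n F E) (r : ℝ) :
    gaugeBracket D (r • R) = r • gaugeBracket D R := by
  have h : ∀ u, gaugeOp (r • R) u = r • gaugeOp R u := fun _ => rfl
  refine gaugeSec_ext (fun m u => ?_) fun m => ?_
  · change (gaugeOp D (gaugeOp (r • R) u) - gaugeOp (r • R) (gaugeOp D u)) m =
      r • (gaugeOp D (gaugeOp R u) - gaugeOp R (gaugeOp D u)) m
    rw [h, h, map_smul]
    simp only [ContMDiffSection.coe_sub, ContMDiffSection.coe_smul, Pi.sub_apply, Pi.smul_apply]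
    module
  · exact congrArg (fun v : VecField n M => v m)
      (VecField.bracket_const_smul (gaugeField D) (gaugeField R) r)

lemma gaugeBracket_add_right [T2Space M] (D R R' : gaugeSections n F E) :
    gaugeBracket D (R + R') = gaugeBracket D R + gaugeBracket D R' := by
  have h : ∀ u, gaugeOp (R + R') u = gaugeOp R u + gaugeOp R' u := fun _ => rfl
  refine gaugeSec_ext (fun m u => ?_) fun m => ?_
  · change (gaugeOp D (gaugeOp (R + R') u) - gaugeOp (R + R') (gaugeOp D u)) m =
      (gaugeOp D (gaugeOp R u) - gaugeOp R (gaugeOp D u)) m +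
        (gaugeOp D (gaugeOp R' u) - gaugeOp R' (gaugeOp D u)) m
    rw [h, h, map_add]
    simp only [ContMDiffSection.coe_sub, ContMDiffSection.coe_add, Pi.sub_apply, Pi.add_apply]
    module
  · exact congrArg (fun v : VecField n M => v m)
      (VecField.bracket_add (gaugeField D) (gaugeField R) (gaugeField R'))

/-- The identity operator, as a section of `𝔇E`. -/
def gaugeOne : gaugeSections n F E :=
  mkGauge LinearMap.id 0 fun f u => by
    ext m
    simp [dirDeriv_zero_left]

variable (n F E)

/-- `Γ(𝔍E)`: a section `μ` of `𝔍E ⊆ Hom(𝔇E, E)` is smooth if it maps smooth sections of `𝔇E` to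
smooth sections of `E`. -/
def jetSections : Submodule ℝ (∀ m : M, JetFiber n F E m) where
  carrier := {μ | ∀ D : gaugeSections n F E,
    IsSmoothSec (n := n) (F := F) fun m => fiberPairing m (μ m) (D.1 m)}
  zero_mem' _ := (0 : Sec n F E).contMDiff
  add_mem' ha hb D := (ha D).add_section (hb D)
  smul_mem' _ _ ha D := (ha D).const_smul_section

variable {n F E}

/-- The `E`-valued pairing `⟨μ, D⟩_E ∈ Γ(E)` of sections of `𝔍E` and `𝔇E`. -/
def pairing (μ : jetSections n F E) (D : gaugeSections n F E) : Sec n F E :=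
  ⟨fun m => fiberPairing m (μ.1 m) (D.1 m), μ.2 D⟩

@[simp] lemma pairing_apply (μ : jetSections n F E) (D : gaugeSections n F E) (m : M) :
    pairing μ D m = fiberPairing m (μ.1 m) (D.1 m) := rfl

/-- The section `𝕕u = [u]` of `𝔍E` for `u ∈ Γ(E)`: `⟨𝕕u, 𝔡⟩_E = 𝔡 u`. -/
def jet (u : Sec n F E) : jetSections n F E :=
  ⟨fun _ => ⟨{ toFun := fun d => gaugeAct d u
               map_add' := fun _ _ => rfl
               map_smul' := fun _ _ => rfl }, fun _ => rfl⟩, fun D => D.2.2 u⟩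

lemma gaugeAct_sum {ι : Type*} (t : Finset ι) (R : ι → gaugeSections n F E) (p : M)
    (u : Sec n F E) : gaugeAct ((∑ i ∈ t, R i).1 p) u = ∑ i ∈ t, gaugeAct ((R i).1 p) u := by
  classical
  induction t using Finset.induction_on with
  | empty => simp
  | insert i t hi ih =>
    rw [Finset.sum_insert hi, Finset.sum_insert hi, ← ih]
    rfl

lemma gaugeAnchor_sum {ι : Type*} (t : Finset ι) (R : ι → gaugeSections n F E) (p : M) :
    gaugeAnchor p ((∑ i ∈ t, R i).1 p) = ∑ i ∈ t, gaugeAnchor p ((R i).1 p) := by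
  rw [← map_sum, AddSubmonoidClass.coe_finsetSum, Finset.sum_apply]

/-- For `D ∈ Γ(𝔇E)` and `μ ∈ Γ(𝔍E)`, the operator
`D' ↦ D⟨μ, D'⟩_E - ⟨μ, [D, D']⟩_E` on `Γ(𝔇E)`. -/
def lieOp [T2Space M] (D : gaugeSections n F E) (μ : jetSections n F E) :
    gaugeSections n F E →ₗ[ℝ] Sec n F E where
  toFun D' := gaugeOp D (pairing μ D') - pairing μ (gaugeBracket D D')
  map_add' R R' := by
    have h1 : pairing μ (R + R') = pairing μ R + pairing μ R' := by
      ext m; exact map_add (fiberPairing m (μ.1 m)) _ _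
    have h2 : pairing μ (gaugeBracket D (R + R')) =
        pairing μ (gaugeBracket D R) + pairing μ (gaugeBracket D R') := by
      rw [gaugeBracket_add_right]
      ext m; exact map_add (fiberPairing m (μ.1 m)) _ _
    rw [h1, h2, map_add]
    abel
  map_smul' r R := by
    have h1 : pairing μ (r • R) = r • pairing μ R := by
      ext m; exact map_smul (fiberPairing m (μ.1 m)) _ _
    have h2 : pairing μ (gaugeBracket D (r • R)) = r • pairing μ (gaugeBracket D R) := by
      rw [gaugeBracket_const_smul_right]
      ext m; exact map_smul (fiberPairing m (μ.1 m)) _ _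
    rw [h1, h2, map_smul, smul_sub]
    rfl

lemma lieOp_smul [T2Space M] (D : gaugeSections n F E) (μ : jetSections n F E) (f : SmoothFun n M)
    (R : gaugeSections n F E) : lieOp D μ (gaugeSmul f R) = fsmul f (lieOp D μ R) := by
  have h1 : pairing μ (gaugeSmul f R) = fsmul f (pairing μ R) := by
    ext m; exact map_smul (fiberPairing m (μ.1 m)) _ _
  have h2 : pairing μ (gaugeBracket D (gaugeSmul f R)) =
      fsmul f (pairing μ (gaugeBracket D R)) + fsmul ((gaugeField D).app f) (pairing μ R) := by
    rw [gaugeBracket_smul_right]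
    ext m
    change fiberPairing m (μ.1 m) (_ • _ + _ • _) = _
    rw [map_add, map_smul, map_smul]
    rfl
  change gaugeOp D (pairing μ (gaugeSmul f R)) - pairing μ (gaugeBracket D (gaugeSmul f R)) =
    fsmul f (gaugeOp D (pairing μ R) - pairing μ (gaugeBracket D R))
  rw [h1, h2, gaugeOp_fsmul]
  ext m
  simp only [ContMDiffSection.coe_sub, ContMDiffSection.coe_add, Pi.sub_apply, Pi.add_apply,
    fsmul_apply]
  module

section Local
variable [T2Space M] [FiniteDimensional ℝ F] [ContMDiffVectorBundle ∞ F E (𝓡 n)]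

/-- The endomorphism `u ↦ ∑ c_j(u) w_j` for function-linear maps `c_j`. -/
def endGauge {k : ℕ} (c : Fin k → Sec n F E →ₗ[ℝ] SmoothFun n M)
    (hc : ∀ j f u, c j (fsmul f u) = f * c j u) (w : Fin k → Sec n F E) : gaugeSections n F E :=
  mkGauge
    { toFun := fun u => ∑ j, fsmul (c j u) (w j)
      map_add' := fun u v => by
        ext m
        simp [sec_sum_apply, add_smul, Finset.sum_add_distrib]
      map_smul' := fun r u => by
        ext m
        simp [sec_sum_apply, mul_smul, Finset.smul_sum] } 0 fun f u => by
    ext m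
    simp [sec_sum_apply, hc, mul_smul, Finset.smul_sum, dirDeriv_zero_left]

/-- The derivative endomorphism `u ↦ ∑ x(c_j(u)) s_j` over `ψ x`, for a local frame `s_j` with
coefficients `c_j`. -/
def connGauge {k : ℕ} {s : Fin k → Sec n F E} {c : Fin k → Sec n F E →ₗ[ℝ] SmoothFun n M}
    {ψ : SmoothFun n M} (hc : ∀ j f u, c j (fsmul f u) = f * c j u)
    (hs : ∀ u, ∑ j, fsmul (c j u) (s j) = fsmul ψ u) (x : VecField n M) : gaugeSections n F E :=
  mkGauge
    { toFun := fun u => ∑ j, fsmul (x.app (c j u)) (s j)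
      map_add' := fun u v => by
        ext m
        simp [sec_sum_apply, add_smul, Finset.sum_add_distrib, dirDeriv_add]
      map_smul' := fun r u => by
        ext m
        simp [sec_sum_apply, mul_smul, Finset.smul_sum, dirDeriv_const_smul] }
    (fsmul ψ x) fun f u => by
    ext m
    have h := congrArg (fun v : Sec n F E => v m) (hs u)
    simp only [sec_sum_apply, fsmul_apply] at h
    simp [sec_sum_apply, hc, dirDeriv_mul, dirDeriv_smul_left, add_smul, Finset.sum_add_distrib,
      Finset.smul_sum, mul_smul]
    rw [smul_comm, ← h, Finset.smul_sum]
    refine Finset.sum_congr rfl fun j _ => ?_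
    rw [smul_comm]

/-- A function-linear operator on `Γ(𝔇E)` with values in `Γ(E)` is pointwise. -/
lemma eq_zero_of_apply_eq_zero (T : gaugeSections n F E →ₗ[ℝ] Sec n F E)
    (hT : ∀ f D, T (gaugeSmul f D) = fsmul f (T D)) (D : gaugeSections n F E) (m : M)
    (hD : D.1 m = 0) : T D m = 0 := by
  obtain ⟨k, s, c, ψ, hψ, hc, hc0, hs⟩ := exists_localFrame (n := n) (F := F) (E := E) m
  obtain ⟨l, z, a, φ, hφ, ha, ha0, hz⟩ := exists_localFrame (n := n)
    (F := EuclideanSpace ℝ (Fin n)) (E := (TangentSpace (𝓡 n) : M → Type _)) m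
  have hψm : ψ m = 1 := hψ.self_of_nhds
  have hφm : φ m = 1 := hφ.self_of_nhds
  have Tsum : ∀ {ι : Type} [Fintype ι] (f : ι → SmoothFun n M) (R : ι → gaugeSections n F E),
      (∀ i, f i m = 0) → T (∑ i, gaugeSmul (f i) (R i)) m = 0 := by
    intro ι _ f R hf
    rw [map_sum, sec_sum_apply]
    exact Finset.sum_eq_zero fun i _ => by simp [hT, hf i]
  have h1 : gaugeSmul ψ D = endGauge c hc (fun j => gaugeOp D (s j)) +
      connGauge hc hs (gaugeField D) + gaugeSmul (-((gaugeField D).app ψ)) gaugeOne := by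
    refine gaugeSec_ext (fun p u => ?_) fun p => ?_
    · have h := congrArg (fun v : Sec n F E => gaugeOp D v p) (hs u)
      simp only [map_sum, sec_sum_apply, gaugeOp_fsmul, ContMDiffSection.coe_add, Pi.add_apply,
        fsmul_apply, Finset.sum_add_distrib] at h
      change ψ p • gaugeAct (D.1 p) u =
        gaugeAct ((endGauge c hc (fun j => gaugeOp D (s j))).1 p) u + gaugeAct ((connGauge hc hs (gaugeField D)).1 p) u +
          (-((gaugeField D).app ψ p)) • u p
      simp only [endGauge, connGauge, gaugeAct_mkGauge, LinearMap.coe_mk, AddHom.coe_mk,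
        sec_sum_apply, fsmul_apply]
      simp only [gaugeOp_apply, VecField.app_apply] at h ⊢
      rw [h]
      module
    · change ψ p • gaugeAnchor p (D.1 p) = 0 + ψ p • gaugeAnchor p (D.1 p) + _ • 0
      simp
  have h2 : ∀ w : Fin k → Sec n F E, gaugeSmul ψ (endGauge c hc w) =
      ∑ i : Fin k × Fin k, gaugeSmul (c i.2 (w i.1)) (endGauge c hc (Pi.single i.1 (s i.2))) := by
    intro w
    refine gaugeSec_ext (fun p u => ?_) fun p => ?_
    · rw [gaugeAct_sum]
      change ψ p • (∑ j, fsmul (c j u) (w j)) p = ∑ i : Fin k × Fin k, c i.2 (w i.1) p •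
        (∑ j, fsmul (c j u) ((Pi.single i.1 (s i.2) : Fin k → Sec n F E) j)) p
      rw [Fintype.sum_prod_type]
      have e : ∀ i i', (∑ j, fsmul (c j u) ((Pi.single i (s i') : Fin k → Sec n F E) j)) p =
          c i u p • s i' p := by
        intro i i'
        rw [sec_sum_apply, Finset.sum_eq_single i]
        · simp
        · intro j _ hj
          simp [Pi.single_eq_of_ne hj]
        · simp
      simp only [e, sec_sum_apply, Finset.smul_sum]
      refine Finset.sum_congr rfl fun j _ => ?_
      have h := congrArg (fun v : Sec n F E => v p) (hs (w j))
      simp only [sec_sum_apply, fsmul_apply] at h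
      rw [fsmul_apply, smul_comm, ← h, Finset.smul_sum]
      exact Finset.sum_congr rfl fun i _ => smul_comm _ _ _
    · rw [gaugeAnchor_sum]
      change ψ p • (0 : TangentSpace (𝓡 n) p) = ∑ i : Fin k × Fin k, c i.2 (w i.1) p •
        (0 : TangentSpace (𝓡 n) p)
      simp
  have h3 : ∀ x : VecField n M, gaugeSmul φ (connGauge hc hs x) =
      ∑ i, gaugeSmul (a i x) (connGauge hc hs (z i)) := by
    intro x
    refine gaugeSec_ext (fun p u => ?_) fun p => ?_
    · rw [gaugeAct_sum]
      change φ p • (∑ j, fsmul (x.app (c j u)) (s j)) p =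
        ∑ i, a i x p • (∑ j, fsmul (VecField.app (z i) (c j u)) (s j)) p
      have h := congrArg (fun v : VecField n M => v p) (hz x)
      simp only [sec_sum_apply, fsmul_apply] at h
      simp only [sec_sum_apply, fsmul_apply, VecField.app_apply, Finset.smul_sum]
      rw [Finset.sum_comm]
      refine Finset.sum_congr rfl fun j _ => ?_
      simp only [smul_smul, ← dirDeriv_smul_left]
      rw [← h, dirDeriv_sum_left, Finset.sum_smul]
    · rw [gaugeAnchor_sum]
      change φ p • ψ p • x p = ∑ i, a i x p • ψ p • z i p
      have h := congrArg (fun v : VecField n M => v p) (hz x)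
      simp only [sec_sum_apply, fsmul_apply] at h
      rw [smul_comm, ← h, Finset.smul_sum]
      exact Finset.sum_congr rfl fun i _ => smul_comm _ _ _
  have e2 : T (endGauge c hc (fun j => gaugeOp D (s j))) m = 0 := by
    have := congrArg (fun R => T R m) (h2 fun j => gaugeOp D (s j))
    simp only [hT, fsmul_apply, hψm, one_smul] at this
    rw [this, Tsum]
    intro i
    exact hc0 _ _ _ (by simp [hD])
  have e3 : T (connGauge hc hs (gaugeField D)) m = 0 := by
    have := congrArg (fun R => T R m) (h3 (gaugeField D))
    simp only [hT, fsmul_apply, hφm, one_smul] at this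
    rw [this, Tsum]
    intro i
    exact ha0 _ _ _ (by simp [hD])
  have := congrArg (fun R => T R m) h1
  simpa [hT, hψm, e2, e3, hD, dirDeriv_zero_left] using this

/-- Every element of `(𝔇E)_m` extends to a smooth section of `𝔇E`. -/
lemma exists_gaugeSection (m : M) (d : GaugeFiber n F E m) :
    ∃ D : gaugeSections n F E, D.1 m = d := by
  obtain ⟨k, s, c, ψ, hψ, hc, hc0, hs⟩ := exists_localFrame (n := n) (F := F) (E := E) m
  have hψm : ψ m = 1 := hψ.self_of_nhds
  obtain ⟨x, hx⟩ := exists_section_apply_eq (n := n) (F := EuclideanSpace ℝ (Fin n)) m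
    (gaugeAnchor m d)
  choose w hw using fun j => exists_section_apply_eq (n := n) (F := F) m (gaugeAct d (s j))
  refine ⟨endGauge c hc w + connGauge hc hs x, gauge_ext (fun u => ?_) ?_⟩
  · have h := congrArg (gaugeAct d) (hs u)
    rw [map_sum, gaugeAct_fsmul, hψm, dirDeriv_congr (g := 1) _ hψ, dirDeriv_one] at h
    simp only [gaugeAct_fsmul, Finset.sum_add_distrib, one_smul, zero_smul, add_zero] at h
    rw [← h]
    change gaugeAct ((endGauge c hc w).1 m) u + gaugeAct ((connGauge hc hs x).1 m) u = _
    simp [endGauge, connGauge, sec_sum_apply, hw, hx]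
  · change 0 + ψ m • x m = _
    simp [hψm, hx]

/-- The kernel of the anchor `(𝔇E)_m → T_m M` is `𝔤𝔩(E_m)`. -/
lemma exists_eq_glIncl (m : M) (d : GaugeFiber n F E m) (hd : gaugeAnchor m d = 0) :
    ∃ Φ : E m →ₗ[ℝ] E m, d = glIncl m Φ := by
  obtain ⟨k, s, c, ψ, hψ, hc, hc0, hs⟩ := exists_localFrame (n := n) (F := F) (E := E) m
  have h0 : ∀ f u, gaugeAct d (fsmul f u) = f m • gaugeAct d u := fun f u => by
    rw [gaugeAct_fsmul, hd, dirDeriv_zero_left, zero_smul, add_zero]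
  have h1 : ∀ u : Sec n F E, u m = 0 → gaugeAct d u = 0 := by
    intro u hu
    have h := congrArg (gaugeAct d) (hs u)
    rw [map_sum, h0, hψ.self_of_nhds, one_smul] at h
    rw [← h]
    exact Finset.sum_eq_zero fun j _ => by rw [h0, hc0 j u m hu, zero_smul]
  have h2 : ∀ u v : Sec n F E, u m = v m → gaugeAct d u = gaugeAct d v := by
    intro u v h
    rw [← sub_eq_zero, ← map_sub]
    exact h1 _ (sub_eq_zero.2 h)
  choose w hw using fun e : E m => exists_section_apply_eq (n := n) (F := F) m e
  refine ⟨{ toFun := fun e => gaugeAct d (w e)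
            map_add' := fun e e' => ?_
            map_smul' := fun r e => ?_ }, gauge_ext (fun u => ?_) hd⟩
  · rw [← map_add]
    exact h2 _ _ (by simp [hw])
  · rw [RingHom.id_apply, ← map_smul]
    exact h2 _ _ (by simp [hw])
  · exact h2 _ _ (hw _).symm

/-- Every `Φ ∈ 𝔤𝔩(E_m)` extends to a smooth section of `𝔤𝔩(E) ⊆ 𝔇E`. -/
lemma exists_endSection (m : M) (Φ : E m →ₗ[ℝ] E m) :
    ∃ D : gaugeSections n F E, D.1 m = glIncl m Φ ∧ gaugeField D = 0 := by
  obtain ⟨k, s, c, ψ, hψ, hc, hc0, hs⟩ := exists_localFrame (n := n) (F := F) (E := E) m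
  have hψm : ψ m = 1 := hψ.self_of_nhds
  choose w hw using fun j => exists_section_apply_eq (n := n) (F := F) m (Φ (s j m))
  refine ⟨endGauge c hc w, gauge_ext (fun u => ?_) rfl, rfl⟩
  have h := congrArg (fun v : Sec n F E => Φ (v m)) (hs u)
  simp [sec_sum_apply, hψm] at h
  simp [endGauge, sec_sum_apply, hw, h]

lemma lieOp_congr (D : gaugeSections n F E) (μ : jetSections n F E) (m : M)
    (R R' : gaugeSections n F E) (h : R.1 m = R'.1 m) : lieOp D μ R m = lieOp D μ R' m := by
  have h0 : (R + (-1 : ℝ) • R').1 m = 0 := by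
    change R.1 m + (-1 : ℝ) • R'.1 m = 0
    rw [h]; module
  have := eq_zero_of_apply_eq_zero (lieOp D μ) (lieOp_smul D μ) _ m h0
  rw [map_add, map_smul] at this
  change lieOp D μ R m + (-1 : ℝ) • lieOp D μ R' m = 0 at this
  rw [← sub_eq_zero, ← this]
  module

lemma pairing_eq_gaugeOp (μ : jetSections n F E) (Q : gaugeSections n F E)
    (hQ : gaugeField Q = 0) : pairing μ Q = gaugeOp Q (pairing μ gaugeOne) := by
  ext p
  obtain ⟨Ψ, hΨ⟩ := exists_eq_glIncl p (Q.1 p) (congrArg (fun x : VecField n M => x p) hQ)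
  rw [pairing_apply, gaugeOp_apply, hΨ, gaugeAct_glIncl, fiberPairing_glIncl]
  rfl

lemma lieOp_end (D : gaugeSections n F E) (μ : jetSections n F E) (m : M) (Φ : E m →ₗ[ℝ] E m)
    (R : gaugeSections n F E) (hR : R.1 m = glIncl m Φ) (hR0 : gaugeField R = 0) :
    lieOp D μ R m = Φ (gaugeOp D (pairing μ gaugeOne) m) := by
  have hB : gaugeField (gaugeBracket D R) = 0 := by
    change (gaugeField D).bracket (gaugeField R) = 0
    rw [hR0, VecField.bracket_zero]
  have h1 : lieOp D μ R =
      gaugeOp D (pairing μ R) - pairing μ (gaugeBracket D R) := rfl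
  have h2 : ∀ u, gaugeOp (gaugeBracket D R) u =
      gaugeOp D (gaugeOp R u) - gaugeOp R (gaugeOp D u) := fun _ => rfl
  rw [h1, pairing_eq_gaugeOp μ R hR0, pairing_eq_gaugeOp μ _ hB, h2, sub_sub_cancel,
    gaugeOp_apply, hR, gaugeAct_glIncl]

lemma exists_lieDer (D : gaugeSections n F E) (μ : jetSections n F E) :
    ∃ ν : jetSections n F E, ∀ D' : gaugeSections n F E,
      pairing ν D' = gaugeOp D (pairing μ D') - pairing μ (gaugeBracket D D') := by
  have wd := lieOp_congr D μ
  choose ex hex using fun m => exists_gaugeSection (n := n) (F := F) (E := E) m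
  let ν : ∀ m : M, GaugeFiber n F E m →ₗ[ℝ] E m := fun m =>
    { toFun := fun d => lieOp D μ (ex m d) m
      map_add' := fun d d' => by
        rw [wd m (ex m (d + d')) (ex m d + ex m d') (by
          rw [hex]; change _ = (ex m d).1 m + (ex m d').1 m; rw [hex, hex]), map_add]
        rfl
      map_smul' := fun r d => by
        rw [wd m (ex m (r • d)) (r • ex m d) (by
          rw [hex]; change _ = r • (ex m d).1 m; rw [hex]), map_smul]
        rfl }
  have hν : ∀ (R : gaugeSections n F E) (m : M), ν m (R.1 m) = lieOp D μ R m := fun R m =>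
    wd m _ _ (hex m _)
  have key : ∀ (m : M) (Φ : E m →ₗ[ℝ] E m),
      ν m (glIncl m Φ) = Φ (gaugeOp D (pairing μ gaugeOne) m) := by
    intro m Φ
    obtain ⟨R, hR, hR0⟩ := exists_endSection (n := n) (F := F) (E := E) m Φ
    rw [← hR, hν]
    exact lieOp_end D μ m Φ R hR hR0
  refine ⟨⟨fun m => ⟨ν m, fun Φ => ?_⟩, fun R => ?_⟩, fun R => ?_⟩
  · rw [key, key]; rfl
  · have : (fun m => ν m (R.1 m)) = fun m => lieOp D μ R m := funext (hν R)
    change IsSmoothSec fun m => ν m (R.1 m)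
    rw [this]
    exact (lieOp D μ R).contMDiff
  · ext m
    exact hν R m

lemma jet_ext {μ ν : jetSections n F E} (h : ∀ D, pairing μ D = pairing ν D) : μ = ν := by
  refine Subtype.ext (funext fun m => Subtype.ext (LinearMap.ext fun d => ?_))
  obtain ⟨D, rfl⟩ := exists_gaugeSection m d
  exact congrArg (fun u : Sec n F E => u m) (h D)

/-- The Lie derivative `𝔏_D μ ∈ Γ(𝔍E)`: the section with
`⟨𝔏_D μ, D'⟩_E = D⟨μ, D'⟩_E - ⟨μ, [D, D']⟩_E` for all `D' ∈ Γ(𝔇E)` (unique by `jet_ext`). -/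
def lieDer (D : gaugeSections n F E) (μ : jetSections n F E) : jetSections n F E :=
  (exists_lieDer D μ).choose

lemma pairing_lieDer (D : gaugeSections n F E) (μ : jetSections n F E)
    (D' : gaugeSections n F E) :
    pairing (lieDer D μ) D' = gaugeOp D (pairing μ D') - pairing μ (gaugeBracket D D') :=
  (exists_lieDer D μ).choose_spec D'

end Local

end Gauge

section Omni

variable (n : ℕ) {M : Type*} [TopologicalSpace M] [ChartedSpace (EuclideanSpace ℝ (Fin n)) M]
    (F : Type*) [NormedAddCommGroup F] [NormedSpace ℝ F] (E : M → Type*)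
    [TopologicalSpace (TotalSpace F E)] [∀ m, AddCommGroup (E m)] [∀ m, Module ℝ (E m)]
    [∀ m, TopologicalSpace (E m)] [FiberBundle F E] [VectorBundle ℝ F E]
    [IsManifold (𝓡 n) ∞ M]

/-- The fibre at `m` of `𝓔 = 𝔇E ⊕ 𝔍E`. -/
abbrev OmniFiber (m : M) : Type _ := GaugeFiber n F E m × JetFiber n F E m

/-- `Γ(𝓔) = Γ(𝔇E) ⊕ Γ(𝔍E)`. -/
def omniSections : Submodule ℝ (∀ m : M, OmniFiber n F E m) where
  carrier := {X | (fun m => (X m).1) ∈ gaugeSections n F E ∧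
    (fun m => (X m).2) ∈ jetSections n F E}
  zero_mem' := ⟨(gaugeSections n F E).zero_mem, (jetSections n F E).zero_mem⟩
  add_mem' ha hb :=
    ⟨(gaugeSections n F E).add_mem ha.1 hb.1, (jetSections n F E).add_mem ha.2 hb.2⟩
  smul_mem' r _ ha :=
    ⟨(gaugeSections n F E).smul_mem r ha.1, (jetSections n F E).smul_mem r ha.2⟩

variable {n F E}

/-- The projection `ρ : 𝓔 → 𝔇E`. -/
def rho (m : M) : OmniFiber n F E m →ₗ[ℝ] GaugeFiber n F E m := LinearMap.fst ℝ _ _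

/-- The `𝔇E`-component of a section of `𝓔`. -/
def gaugePart (X : omniSections n F E) : gaugeSections n F E := ⟨fun m => (X.1 m).1, X.2.1⟩

/-- The `𝔍E`-component of a section of `𝓔`. -/
def jetPart (X : omniSections n F E) : jetSections n F E := ⟨fun m => (X.1 m).2, X.2.2⟩

/-- The symmetric `E`-valued form `(𝔡 + μ, 𝔯 + ν)_E = ½ (⟨𝔡, ν⟩_E + ⟨𝔯, μ⟩_E)` on `𝓔_m`. -/
def omniPairing {m : M} (X Y : OmniFiber n F E m) : E m :=
  (1 / 2 : ℝ) • (fiberPairing m Y.2 X.1 + fiberPairing m X.2 Y.1)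

/-- The Dorfman bracket on `Γ(𝓔)`:
`{𝔡 + μ, 𝔯 + ν} = [𝔡, 𝔯] + 𝔏_𝔡 ν - 𝔏_𝔯 μ + 𝕕⟨μ, 𝔯⟩_E`. -/
def dorfman [T2Space M] [FiniteDimensional ℝ F] [ContMDiffVectorBundle ∞ F E (𝓡 n)]
    (X Y : omniSections n F E) : omniSections n F E :=
  ⟨fun m => ((gaugeBracket (gaugePart X) (gaugePart Y)).1 m,
      (lieDer (gaugePart X) (jetPart Y) - lieDer (gaugePart Y) (jetPart X) +
        jet (pairing (jetPart X) (gaugePart Y))).1 m),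
    (gaugeBracket (gaugePart X) (gaugePart Y)).2,
    (lieDer (gaugePart X) (jetPart Y) - lieDer (gaugePart Y) (jetPart X) +
        jet (pairing (jetPart X) (gaugePart Y))).2⟩

end Omni

section Algebroid

variable (n : ℕ) {M : Type*} [TopologicalSpace M] [ChartedSpace (EuclideanSpace ℝ (Fin n)) M]
    {A : M → Type*} [∀ m, AddCommGroup (A m)] [∀ m, Module ℝ (A m)]

/-- A family of real vector spaces `A_m`, `m ∈ M`, with a space `Γ` of sections, is a smooth vector
bundle with `Γ` as its space of smooth sections: `Γ` is a module over the smooth functions, being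
in `Γ` is a local property, and around every point there are finitely many sections in `Γ` that
form a basis of each nearby fibre and with respect to which every section in `Γ` has smooth
coefficients. (On a Hausdorff manifold, germs of smooth functions and of smooth sections are germs
of global ones. The rank may differ between connected components.) -/
structure IsSmoothBundle (Γ : Submodule ℝ (∀ m, A m)) : Prop where
  smul_mem : ∀ (f : SmoothFun n M) {s : ∀ m, A m}, s ∈ Γ → (fun m => f m • s m) ∈ Γ
  mem_of_locally : ∀ s : ∀ m, A m, (∀ m, ∃ t ∈ Γ, ∀ᶠ p in 𝓝 m, s p = t p) → s ∈ Γ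
  exists_frame : ∀ m : M, ∃ (r : ℕ) (e : Fin r → Γ),
    (∀ᶠ p in 𝓝 m, LinearIndependent ℝ (fun i => (e i).1 p) ∧
      Submodule.span ℝ (Set.range fun i => (e i).1 p) = ⊤) ∧
    ∀ s ∈ Γ, ∃ c : Fin r → SmoothFun n M, ∀ᶠ p in 𝓝 m, s p = ∑ i, c i p • (e i).1 p

variable [IsManifold (𝓡 n) ∞ M]

/-- A Lie algebroid over `M`: a smooth vector bundle `A`, a Lie bracket on its space `Γ` of smooth
sections and a smooth bundle map `a : A → TM`, the anchor, such that
`[s, f t] = f [s, t] + a(s)(f) t` and `a[s, t] = [a(s), a(t)]`. -/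
structure IsLieAlgebroid (Γ : Submodule ℝ (∀ m, A m)) (bracket : Γ → Γ → Γ)
    (a : ∀ m, A m →ₗ[ℝ] TangentSpace (𝓡 n) m) : Prop where
  isSmoothBundle : IsSmoothBundle n Γ
  anchor_smooth : ∀ s : Γ, IsSmoothSec (n := n) (F := EuclideanSpace ℝ (Fin n))
    (E := (TangentSpace (𝓡 n) : M → Type _)) (fun m => a m (s.1 m))
  add_left : ∀ s s' t, bracket (s + s') t = bracket s t + bracket s' t
  smul_left : ∀ (r : ℝ) s t, bracket (r • s) t = r • bracket s t
  add_right : ∀ s t t', bracket s (t + t') = bracket s t + bracket s t'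
  smul_right : ∀ (r : ℝ) s t, bracket s (r • t) = r • bracket s t
  alternating : ∀ s, bracket s s = 0
  jacobi : ∀ s t u,
    bracket s (bracket t u) + bracket t (bracket u s) + bracket u (bracket s t) = 0
  leibniz : ∀ (f : SmoothFun n M) (s t : Γ) (m : M),
    (bracket s ⟨fun p => f p • t.1 p, isSmoothBundle.smul_mem f t.2⟩).1 m =
      f m • (bracket s t).1 m + dirDeriv (a m (s.1 m)) f • t.1 m
  anchor_bracket : ∀ (s t : Γ) (m : M), a m ((bracket s t).1 m) =
    VectorField.mlieBracket (𝓡 n) (fun p => a p (s.1 p)) (fun p => a p (t.1 p)) m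

variable {n}
variable {F : Type*} [NormedAddCommGroup F] [NormedSpace ℝ F] {E : M → Type*}
    [TopologicalSpace (TotalSpace F E)] [∀ m, AddCommGroup (E m)] [∀ m, Module ℝ (E m)]
    [∀ m, TopologicalSpace (E m)] [FiberBundle F E] [VectorBundle ℝ F E] [T2Space M]

/-- A representation on `E` of a Lie algebroid `A` with smooth sections `Γ` and anchor `a`: a
morphism of Lie algebroids `T : A → 𝔇E` over the identity of `M`, that is, a smooth bundle map
compatible with the anchors and with the brackets. -/
structure IsRepresentation (Γ : Submodule ℝ (∀ m, A m)) (bracket : Γ → Γ → Γ)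
    (a : ∀ m, A m →ₗ[ℝ] TangentSpace (𝓡 n) m)
    (T : ∀ m, A m →ₗ[ℝ] GaugeFiber n F E m) : Prop where
  smooth : ∀ s : Γ, (fun m => T m (s.1 m)) ∈ gaugeSections n F E
  anchor : ∀ m (v : A m), gaugeAnchor m (T m v) = a m v
  map_bracket : ∀ (s t : Γ) (m : M), T m ((bracket s t).1 m) =
    (gaugeBracket ⟨fun p => T p (s.1 p), smooth s⟩ ⟨fun p => T p (t.1 p), smooth t⟩).1 m

end Algebroid

section Dirac

variable {n : ℕ} {M : Type*} [TopologicalSpace M] [ChartedSpace (EuclideanSpace ℝ (Fin n)) M]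
    {F : Type*} [NormedAddCommGroup F] [NormedSpace ℝ F] {E : M → Type*}
    [TopologicalSpace (TotalSpace F E)] [∀ m, AddCommGroup (E m)] [∀ m, Module ℝ (E m)]
    [∀ m, TopologicalSpace (E m)] [FiberBundle F E] [VectorBundle ℝ F E]
    [IsManifold (𝓡 n) ∞ M]

/-- `Γ(L)` for a family `L` of subspaces of the fibres of `𝓔`: the smooth sections of `𝓔` with
values in `L`. -/
def subSections (L : ∀ m : M, Submodule ℝ (OmniFiber n F E m)) : Submodule ℝ (∀ m, L m) where
  carrier := {s | (fun m => (s m : OmniFiber n F E m)) ∈ omniSections n F E}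
  zero_mem' := (omniSections n F E).zero_mem
  add_mem' ha hb := (omniSections n F E).add_mem ha hb
  smul_mem' r _ ha := (omniSections n F E).smul_mem r ha

/-- A section of `L` as a section of `𝓔`. -/
def inclSection {L : ∀ m : M, Submodule ℝ (OmniFiber n F E m)} (s : subSections L) :
    omniSections n F E := ⟨fun m => (s.1 m : OmniFiber n F E m), s.2⟩

variable [T2Space M] [FiniteDimensional ℝ F] [ContMDiffVectorBundle ∞ F E (𝓡 n)]

/-- A Dirac structure: a subbundle `L` of `𝓔` whose fibres are maximal isotropic and whose space of
smooth sections is closed under the Dorfman bracket. -/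
structure IsDirac (L : ∀ m : M, Submodule ℝ (OmniFiber n F E m)) : Prop where
  isSubbundle : IsSmoothBundle n (A := fun m => L m) (subSections L)
  maximalIsotropic : ∀ m, Maximal (fun W : Submodule ℝ (OmniFiber n F E m) =>
    ∀ v ∈ W, ∀ w ∈ W, omniPairing v w = 0) (L m)
  closed : ∀ (s t : subSections L) (m : M), (dorfman (inclSection s) (inclSection t)).1 m ∈ L m

/-- The Dorfman bracket restricted to the sections of a Dirac structure. -/
def restrictedBracket {L : ∀ m : M, Submodule ℝ (OmniFiber n F E m)} (hL : IsDirac L)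
    (s t : subSections L) : subSections L :=
  ⟨fun m => ⟨(dorfman (inclSection s) (inclSection t)).1 m, hL.closed s t m⟩,
    (dorfman (inclSection s) (inclSection t)).2⟩

/-- The restriction `ρ|_L : L → 𝔇E`. -/
def rhoRestrict (L : ∀ m : M, Submodule ℝ (OmniFiber n F E m)) (m : M) :
    L m →ₗ[ℝ] GaugeFiber n F E m := (rho m).comp (L m).subtype

end Dirac

end OmniLie

end

/-!
The Dorfman bracket is a Leibniz bracket for purely algebraic reasons. The sections of `𝔇E` form a
Lie algebra `𝔤` acting on `V = Γ(E)`, and `Γ(𝔍E)` with its Lie derivative is, via the nondegenerate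
pairing, a submodule `J` of the `𝔤`-module `Hom(𝔤, V)`, with an equivariant map `𝕕 : V → J`. This
alone forces the left Leibniz identity on `𝔤 ⊕ J`. Since `{X, X} = 𝕕(X, X)_E`, the bracket is
alternating on an isotropic `L`, and there the Leibniz identity becomes the Jacobi identity. The
rule `{X, f Y} = f {X, Y} + a(X)(f) Y` rests on Cartan's formula: `D ↦ 𝔏_D μ - 𝕕⟨μ, D⟩` is linear
over functions, although neither summand is.
-/

noncomputable section

namespace OmniLie

section Leibniz

variable {R A : Type*} [CommRing R] [AddCommGroup A] [Module R A]

lemma jacobi_of_isAlt_of_leibniz {B : A →ₗ[R] A →ₗ[R] A} (halt : B.IsAlt)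
    (hleib : ∀ x y z, B x (B y z) = B (B x y) z + B y (B x z)) (x y z : A) :
    B x (B y z) + B y (B z x) + B z (B x y) = 0 := by
  rw [hleib x y z, ← halt.neg x z, ← halt.neg (B x y) z, map_neg]
  abel

variable {𝔤 V J : Type*} [LieRing 𝔤] [LieAlgebra R 𝔤]
    [AddCommGroup V] [Module R V] [LieRingModule 𝔤 V] [LieModule R 𝔤 V]
    [AddCommGroup J] [Module R J] [LieRingModule 𝔤 J] [LieModule R 𝔤 J]

/-- The algebraic Dorfman bracket `{x + μ, y + ν} = [x, y] + x·ν - y·μ + d⟨μ, y⟩` on `𝔤 ⊕ J`, for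
modules `V`, `J` over a Lie algebra `𝔤`, a pairing `J → Hom(𝔤, V)` and a map `d : V → J`. -/
def omniBracket (pair : J →ₗ⁅R,𝔤⁆ (𝔤 →ₗ[R] V)) (d : V →ₗ⁅R,𝔤⁆ J) :
    𝔤 × J →ₗ[R] 𝔤 × J →ₗ[R] 𝔤 × J :=
  LinearMap.mk₂ R (fun X Y => (⁅X.1, Y.1⁆, ⁅X.1, Y.2⁆ - ⁅Y.1, X.2⁆ + d (pair X.2 Y.1)))
    (fun X X' Y => by ext <;> simp; abel)
    (fun r X Y => by ext <;> simp [smul_sub])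
    (fun X Y Y' => by ext <;> simp; abel)
    (fun r X Y => by ext <;> simp [smul_sub])

variable (pair : J →ₗ⁅R,𝔤⁆ (𝔤 →ₗ[R] V)) (d : V →ₗ⁅R,𝔤⁆ J)

lemma omniBracket_apply (X Y : 𝔤 × J) :
    omniBracket pair d X Y =
      (⁅X.1, Y.1⁆, ⁅X.1, Y.2⁆ - ⁅Y.1, X.2⁆ + d (pair X.2 Y.1)) := rfl

lemma omniBracket_self (X : 𝔤 × J) : omniBracket pair d X X = (0, d (pair X.2 X.1)) := by
  simp [omniBracket_apply]

lemma omniBracket_leibniz (hd : ∀ u x, pair (d u) x = ⁅x, u⁆) (X Y Z : 𝔤 × J) :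
    omniBracket pair d X (omniBracket pair d Y Z) =
      omniBracket pair d (omniBracket pair d X Y) Z +
        omniBracket pair d Y (omniBracket pair d X Z) := by
  obtain ⟨x, μ⟩ := X
  obtain ⟨y, ν⟩ := Y
  obtain ⟨z, ξ⟩ := Z
  ext
  · exact leibniz_lie x y z
  · simp only [omniBracket_apply, Prod.mk_add_mk, lie_add, lie_sub, lie_lie, map_add, map_sub,
      LinearMap.add_apply, LinearMap.sub_apply, hd, LieModuleHom.map_lie, LieHom.lie_apply]
    abel

end Leibniz

section VectorFields

variable {n : ℕ} {M : Type*} [TopologicalSpace M]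
    [ChartedSpace (EuclideanSpace ℝ (Fin n)) M] [IsManifold (𝓡 n) ∞ M]

lemma VecField.bracket_swap (x y : VecField n M) : x.bracket y = -y.bracket x := by
  ext p
  exact VectorField.mlieBracket_swap_apply

lemma VecField.bracket_leibniz (x y z : VecField n M) :
    x.bracket (y.bracket z) = (x.bracket y).bracket z + y.bracket (x.bracket z) := by
  have : IsManifold (𝓡 n) (minSmoothness ℝ 3) M := by
    rw [minSmoothness_of_isRCLikeNormedField]; infer_instance
  have contMDiff_two (w : VecField n M) : ContMDiff (𝓡 n) (𝓡 n).tangent (minSmoothness ℝ 2)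
      (fun p => (⟨p, w p⟩ : TangentBundle (𝓡 n) M)) := by
    rw [minSmoothness_of_isRCLikeNormedField]; exact w.contMDiff.of_le ENat.LEInfty.out
  ext p
  exact VectorField.leibniz_identity_mlieBracket_apply
    (contMDiff_two x p) (contMDiff_two y p) (contMDiff_two z p)

instance instLieRingVecField : LieRing (VecField n M) where
  bracket := VecField.bracket
  add_lie x y z := by
    change (x + y).bracket z = x.bracket z + y.bracket z
    rw [VecField.bracket_swap, VecField.bracket_add, VecField.bracket_swap x z,
      VecField.bracket_swap y z, neg_add]
  lie_add := VecField.bracket_add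
  lie_self x := by
    ext p
    exact congrFun VectorField.mlieBracket_self p
  leibniz_lie := VecField.bracket_leibniz

end VectorFields

section GaugeAndJets

variable {n : ℕ} {M : Type*} [TopologicalSpace M]
    [ChartedSpace (EuclideanSpace ℝ (Fin n)) M] [IsManifold (𝓡 n) ∞ M]
    {F : Type*} [NormedAddCommGroup F] [NormedSpace ℝ F] {E : M → Type*}
    [TopologicalSpace (TotalSpace F E)] [∀ m, AddCommGroup (E m)] [∀ m, Module ℝ (E m)]
    [∀ m, TopologicalSpace (E m)] [FiberBundle F E] [VectorBundle ℝ F E]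

lemma gaugeSections_ext {D D' : gaugeSections n F E} (h : ∀ u, gaugeOp D u = gaugeOp D' u)
    (h' : gaugeField D = gaugeField D') : D = D' :=
  gaugeSec_ext (fun m u => DFunLike.congr_fun (h u) m) fun m => DFunLike.congr_fun h' m

lemma gaugeOp_add (D R : gaugeSections n F E) (u : Sec n F E) :
    gaugeOp (D + R) u = gaugeOp D u + gaugeOp R u := rfl

/-- The product `f μ` of a smooth function and a section of `𝔍E`. -/
def jetSmul (f : SmoothFun n M) (μ : jetSections n F E) : jetSections n F E :=
  ⟨fun m => f m • μ.1 m, fun D => f.contMDiff.smul_section (μ.2 D)⟩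

lemma jetSmul_sub (f : SmoothFun n M) (μ ν : jetSections n F E) :
    jetSmul f (μ - ν) = jetSmul f μ - jetSmul f ν :=
  Subtype.ext (funext fun m => smul_sub (f m) (μ.1 m) (ν.1 m))

lemma pairing_jetSmul (f : SmoothFun n M) (μ : jetSections n F E) (D : gaugeSections n F E) :
    pairing (jetSmul f μ) D = fsmul f (pairing μ D) := rfl

lemma pairing_gaugeSmul (μ : jetSections n F E) (f : SmoothFun n M) (D : gaugeSections n F E) :
    pairing μ (gaugeSmul f D) = fsmul f (pairing μ D) := by
  ext m
  exact map_smul (fiberPairing m (μ.1 m)) _ _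

/-- The pairing `Γ(𝔍E) × Γ(𝔇E) → Γ(E)` as a bilinear map. -/
def pairingLinear : jetSections n F E →ₗ[ℝ] gaugeSections n F E →ₗ[ℝ] Sec n F E :=
  LinearMap.mk₂ ℝ pairing (fun _ _ _ => rfl) (fun _ _ _ => rfl)
    (fun μ D R => by ext m; exact map_add (fiberPairing m (μ.1 m)) (D.1 m) (R.1 m))
    (fun r μ D => by ext m; exact map_smul (fiberPairing m (μ.1 m)) r (D.1 m))

lemma pairingLinear_apply (μ : jetSections n F E) (D : gaugeSections n F E) :
    pairingLinear μ D = pairing μ D := rfl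

variable [T2Space M]

lemma gaugeOp_gaugeBracket (D R : gaugeSections n F E) (u : Sec n F E) :
    gaugeOp (gaugeBracket D R) u = gaugeOp D (gaugeOp R u) - gaugeOp R (gaugeOp D u) := rfl

lemma gaugeBracket_add_left (D R S : gaugeSections n F E) :
    gaugeBracket (D + R) S = gaugeBracket D S + gaugeBracket R S :=
  gaugeSections_ext
    (fun u => by
      simp only [gaugeOp_add, gaugeOp_gaugeBracket, map_add]
      abel)
    (add_lie (gaugeField D) (gaugeField R) (gaugeField S))

lemma gaugeBracket_leibniz (D R S : gaugeSections n F E) :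
    gaugeBracket D (gaugeBracket R S) =
      gaugeBracket (gaugeBracket D R) S + gaugeBracket R (gaugeBracket D S) :=
  gaugeSections_ext
    (fun u => by
      simp only [gaugeOp_add, gaugeOp_gaugeBracket, map_sub]
      abel)
    (leibniz_lie (gaugeField D) (gaugeField R) (gaugeField S))

instance instLieRingGaugeSections : LieRing (gaugeSections n F E) where
  bracket := gaugeBracket
  add_lie := gaugeBracket_add_left
  lie_add := gaugeBracket_add_right
  lie_self D := gaugeSections_ext (fun _ => sub_self _) (lie_self (gaugeField D))
  leibniz_lie := gaugeBracket_leibniz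

instance instLieAlgebraGaugeSections : LieAlgebra ℝ (gaugeSections n F E) where
  lie_smul r D R := gaugeBracket_const_smul_right D R r

instance instLieRingModuleSec : LieRingModule (gaugeSections n F E) (Sec n F E) where
  bracket D u := gaugeOp D u
  add_lie := gaugeOp_add
  lie_add D := map_add (gaugeOp D)
  leibniz_lie _ _ _ := (sub_add_cancel _ _).symm

instance instLieModuleSec : LieModule ℝ (gaugeSections n F E) (Sec n F E) where
  smul_lie _ _ _ := rfl
  lie_smul r D := map_smul (gaugeOp D) r

lemma gaugeBracket_smul_left (f : SmoothFun n M) (D R : gaugeSections n F E) :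
    gaugeBracket (gaugeSmul f D) R =
      gaugeSmul f (gaugeBracket D R) - gaugeSmul ((gaugeField R).app f) D := by
  have bracket_swap (S T : gaugeSections n F E) : gaugeBracket S T = -gaugeBracket T S :=
    (lie_skew S T).symm
  rw [bracket_swap, gaugeBracket_smul_right, bracket_swap D R]
  refine Subtype.ext (funext fun m => ?_)
  change -(f m • (gaugeBracket R D).1 m + (gaugeField R).app f m • D.1 m) =
    f m • -(gaugeBracket R D).1 m - (gaugeField R).app f m • D.1 m
  module

variable [FiniteDimensional ℝ F] [ContMDiffVectorBundle ∞ F E (𝓡 n)]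

lemma pairingLinear_injective :
    Function.Injective (pairingLinear : jetSections n F E →ₗ[ℝ] _ →ₗ[ℝ] Sec n F E) :=
  fun _ _ h => jet_ext (LinearMap.congr_fun h)

lemma pairingLinear_lieDer (D : gaugeSections n F E) (μ : jetSections n F E) :
    pairingLinear (lieDer D μ) = ⁅D, pairingLinear μ⁆ :=
  LinearMap.ext (pairing_lieDer D μ)

instance instLieRingModuleJetSections :
    LieRingModule (gaugeSections n F E) (jetSections n F E) where
  bracket := lieDer
  add_lie D R μ := pairingLinear_injective <| by
    simp only [map_add, pairingLinear_lieDer, add_lie]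
  lie_add D μ ν := pairingLinear_injective <| by
    simp only [map_add, pairingLinear_lieDer, lie_add]
  leibniz_lie D R μ := pairingLinear_injective <| by
    simp only [map_add, pairingLinear_lieDer, leibniz_lie D R (pairingLinear μ)]

instance instLieModuleJetSections : LieModule ℝ (gaugeSections n F E) (jetSections n F E) where
  smul_lie r D μ := pairingLinear_injective <|
    (pairingLinear_lieDer _ _).trans <| by
      rw [smul_lie, map_smul, ← pairingLinear_lieDer]; rfl
  lie_smul r D μ := pairingLinear_injective <|
    (pairingLinear_lieDer _ _).trans <| by
      rw [map_smul, map_smul, lie_smul, ← pairingLinear_lieDer]; rfl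

/-- The pairing as the embedding of `Γ(𝔍E)` into the `Γ(𝔇E)`-module `Hom(Γ(𝔇E), Γ(E))`. -/
def pairingHom :
    jetSections n F E →ₗ⁅ℝ, gaugeSections n F E⁆ (gaugeSections n F E →ₗ[ℝ] Sec n F E) where
  __ := pairingLinear
  map_lie' := pairingLinear_lieDer _ _

/-- The map `𝕕 : Γ(E) → Γ(𝔍E)` as a homomorphism of `Γ(𝔇E)`-modules. -/
def jetHom : Sec n F E →ₗ⁅ℝ, gaugeSections n F E⁆ jetSections n F E where
  toFun := jet
  map_add' u v := jet_ext fun R => map_add (gaugeOp R) u v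
  map_smul' r u := jet_ext fun R => map_smul (gaugeOp R) r u
  map_lie' {D u} := jet_ext fun R =>
    ((pairing_lieDer D (jet u) R).trans (sub_sub_cancel _ (gaugeOp R (gaugeOp D u)))).symm

lemma pairingHom_jetHom_apply (u : Sec n F E) (D : gaugeSections n F E) :
    pairingHom (jetHom u) D = ⁅D, u⁆ := rfl

lemma lieDer_jetSmul (D : gaugeSections n F E) (f : SmoothFun n M) (μ : jetSections n F E) :
    lieDer D (jetSmul f μ) = jetSmul f (lieDer D μ) + jetSmul ((gaugeField D).app f) μ :=
  jet_ext fun R => by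
    change _ = pairing (jetSmul f (lieDer D μ)) R + pairing (jetSmul _ μ) R
    simp only [pairing_lieDer, pairing_jetSmul, gaugeOp_fsmul]
    ext m
    simp only [ContMDiffSection.coe_sub, ContMDiffSection.coe_add, Pi.sub_apply, Pi.add_apply,
      fsmul_apply]
    module

lemma lieDer_gaugeSmul_sub_jet (f : SmoothFun n M) (D : gaugeSections n F E)
    (μ : jetSections n F E) :
    lieDer (gaugeSmul f D) μ - jet (pairing μ (gaugeSmul f D)) =
      jetSmul f (lieDer D μ - jet (pairing μ D)) :=
  jet_ext fun R => by
    change pairing (lieDer (gaugeSmul f D) μ) R - gaugeOp R (pairing μ (gaugeSmul f D)) =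
      fsmul f (pairing (lieDer D μ) R - gaugeOp R (pairing μ D))
    have pairing_bracket : pairing μ (gaugeBracket (gaugeSmul f D) R) =
        fsmul f (pairing μ (gaugeBracket D R)) - fsmul ((gaugeField R).app f) (pairing μ D) := by
      rw [gaugeBracket_smul_left, ← pairingLinear_apply, map_sub, pairingLinear_apply,
        pairingLinear_apply, pairing_gaugeSmul, pairing_gaugeSmul]
    rw [pairing_lieDer, pairing_lieDer, pairing_bracket, pairing_gaugeSmul, gaugeOp_fsmul]
    ext m
    change f m • gaugeOp D (pairing μ R) m - (f m • pairing μ (gaugeBracket D R) m -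
        (gaugeField R).app f m • pairing μ D m) -
        (f m • gaugeOp R (pairing μ D) m + (gaugeField R).app f m • pairing μ D m) =
      f m • (gaugeOp D (pairing μ R) m - pairing μ (gaugeBracket D R) m -
        gaugeOp R (pairing μ D) m)
    module

end GaugeAndJets

section Dorfman

variable {n : ℕ} {M : Type*} [TopologicalSpace M]
    [ChartedSpace (EuclideanSpace ℝ (Fin n)) M] [IsManifold (𝓡 n) ∞ M]
    {F : Type*} [NormedAddCommGroup F] [NormedSpace ℝ F] {E : M → Type*}
    [TopologicalSpace (TotalSpace F E)] [∀ m, AddCommGroup (E m)] [∀ m, Module ℝ (E m)]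
    [∀ m, TopologicalSpace (E m)] [FiberBundle F E] [VectorBundle ℝ F E]

/-- The product `f X` of a smooth function and a section of `𝓔`. -/
def omniSmul (f : SmoothFun n M) (X : omniSections n F E) : omniSections n F E :=
  ⟨fun m => f m • X.1 m, (gaugeSmul f (gaugePart X)).2, (jetSmul f (jetPart X)).2⟩

/-- The identification of `Γ(𝓔)` with `Γ(𝔇E) × Γ(𝔍E)`, as a linear map. -/
def omniParts : omniSections n F E →ₗ[ℝ] gaugeSections n F E × jetSections n F E where
  toFun X := (gaugePart X, jetPart X)
  map_add' _ _ := rfl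
  map_smul' _ _ := rfl

lemma omniParts_injective :
    Function.Injective (omniParts : omniSections n F E →ₗ[ℝ] _ × _) := fun _ _ h =>
  Subtype.ext (funext fun m => Prod.ext
    (congrFun (congrArg Subtype.val (congrArg Prod.fst h)) m)
    (congrFun (congrArg Subtype.val (congrArg Prod.snd h)) m))

variable [T2Space M] [FiniteDimensional ℝ F] [ContMDiffVectorBundle ∞ F E (𝓡 n)]

lemma omniParts_dorfman (X Y : omniSections n F E) :
    omniParts (dorfman X Y) = omniBracket pairingHom jetHom (omniParts X) (omniParts Y) := rfl

/-- The Dorfman bracket as an `ℝ`-bilinear map. -/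
def dorfmanLinear : omniSections n F E →ₗ[ℝ] omniSections n F E →ₗ[ℝ] omniSections n F E :=
  LinearMap.mk₂ ℝ dorfman
    (fun X X' Y => omniParts_injective <| by
      simp only [omniParts_dorfman, map_add, LinearMap.add_apply])
    (fun r X Y => omniParts_injective <| by
      simp only [omniParts_dorfman, map_smul, LinearMap.smul_apply])
    (fun X Y Y' => omniParts_injective <| by simp only [omniParts_dorfman, map_add])
    (fun r X Y => omniParts_injective <| by simp only [omniParts_dorfman, map_smul])

lemma dorfman_leibniz (X Y Z : omniSections n F E) :
    dorfman X (dorfman Y Z) = dorfman (dorfman X Y) Z + dorfman Y (dorfman X Z) :=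
  omniParts_injective <| by
    simp only [omniParts_dorfman, map_add]
    exact omniBracket_leibniz pairingHom jetHom pairingHom_jetHom_apply
      (omniParts X) (omniParts Y) (omniParts Z)

lemma dorfman_self_eq_zero {X : omniSections n F E}
    (h : pairing (jetPart X) (gaugePart X) = 0) : dorfman X X = 0 :=
  omniParts_injective <| (omniBracket_self pairingHom jetHom (omniParts X)).trans <|
    congrArg (Prod.mk 0) ((congrArg jetHom h).trans (map_zero jetHom))

lemma dorfman_omniSmul (X Y : omniSections n F E) (f : SmoothFun n M) :
    dorfman X (omniSmul f Y) =
      omniSmul f (dorfman X Y) + omniSmul ((gaugeField (gaugePart X)).app f) Y := by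
  set D := gaugePart X
  set R := gaugePart Y
  set μ := jetPart X
  set ν := jetPart Y
  have gauge_eq : gaugeBracket D (gaugeSmul f R) =
      gaugeSmul f (gaugeBracket D R) + gaugeSmul ((gaugeField D).app f) R :=
    gaugeBracket_smul_right D R f
  have jet_eq : lieDer D (jetSmul f ν) - lieDer (gaugeSmul f R) μ +
        jet (pairing μ (gaugeSmul f R)) =
      jetSmul f (lieDer D ν - lieDer R μ + jet (pairing μ R)) +
        jetSmul ((gaugeField D).app f) ν := by
    rw [sub_add, lieDer_gaugeSmul_sub_jet, lieDer_jetSmul, sub_add, jetSmul_sub f (lieDer D ν)]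
    abel
  exact omniParts_injective (Prod.ext gauge_eq jet_eq)

end Dorfman

section Dirac

variable {n : ℕ} {M : Type*} [TopologicalSpace M]
    [ChartedSpace (EuclideanSpace ℝ (Fin n)) M] [IsManifold (𝓡 n) ∞ M]
    {F : Type*} [NormedAddCommGroup F] [NormedSpace ℝ F] {E : M → Type*}
    [TopologicalSpace (TotalSpace F E)] [∀ m, AddCommGroup (E m)] [∀ m, Module ℝ (E m)]
    [∀ m, TopologicalSpace (E m)] [FiberBundle F E] [VectorBundle ℝ F E]
    {L : ∀ m : M, Submodule ℝ (OmniFiber n F E m)}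

/-- The fibres of `L` are isotropic for `(·,·)_E`. -/
def IsIsotropic (L : ∀ m : M, Submodule ℝ (OmniFiber n F E m)) : Prop :=
  ∀ m, ∀ v ∈ L m, ∀ w ∈ L m, omniPairing v w = 0

lemma inclSection_injective : Function.Injective (inclSection (L := L)) := fun _ _ h =>
  Subtype.ext (funext fun m => Subtype.ext (congrFun (congrArg Subtype.val h) m))

lemma IsIsotropic.pairing_self (hiso : IsIsotropic L) (s : subSections L) :
    pairing (jetPart (inclSection s)) (gaugePart (inclSection s)) = 0 := by
  ext m
  have h := hiso m _ (s.1 m).2 _ (s.1 m).2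
  rwa [omniPairing, ← two_smul ℝ, smul_smul, one_div_mul_cancel two_ne_zero, one_smul] at h

variable [T2Space M] [FiniteDimensional ℝ F] [ContMDiffVectorBundle ∞ F E (𝓡 n)]

/-- The space of smooth sections of `L` is closed under the Dorfman bracket. -/
def IsInvolutive (L : ∀ m : M, Submodule ℝ (OmniFiber n F E m)) : Prop :=
  ∀ (s t : subSections L) (m : M), (dorfman (inclSection s) (inclSection t)).1 m ∈ L m

/-- The Dorfman bracket on the sections of an involutive `L`, as an `ℝ`-bilinear map. -/
def IsInvolutive.bracket (hinv : IsInvolutive L) :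
    subSections L →ₗ[ℝ] subSections L →ₗ[ℝ] subSections L :=
  LinearMap.mk₂ ℝ
    (fun s t => ⟨fun m => ⟨(dorfman (inclSection s) (inclSection t)).1 m, hinv s t m⟩,
      (dorfman (inclSection s) (inclSection t)).2⟩)
    (fun s s' t => inclSection_injective <|
      LinearMap.map_add₂ dorfmanLinear (inclSection s) (inclSection s') (inclSection t))
    (fun r s t => inclSection_injective <|
      LinearMap.map_smul₂ dorfmanLinear r (inclSection s) (inclSection t))
    (fun s t t' => inclSection_injective <|
      map_add (dorfmanLinear (inclSection s)) (inclSection t) (inclSection t'))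
    (fun r s t => inclSection_injective <|
      map_smul (dorfmanLinear (inclSection s)) r (inclSection t))

lemma IsInvolutive.bracket_isAlt (hinv : IsInvolutive L) (hiso : IsIsotropic L) :
    hinv.bracket.IsAlt := fun s =>
  inclSection_injective (dorfman_self_eq_zero (hiso.pairing_self s))

lemma IsInvolutive.bracket_leibniz (hinv : IsInvolutive L) (s t u : subSections L) :
    hinv.bracket s (hinv.bracket t u) =
      hinv.bracket (hinv.bracket s t) u + hinv.bracket t (hinv.bracket s u) :=
  inclSection_injective (dorfman_leibniz (inclSection s) (inclSection t) (inclSection u))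

end Dirac

end OmniLie

end

theorem mainTheorem5_general {n : ℕ} {M : Type*} [TopologicalSpace M] [T2Space M]
    [ChartedSpace (EuclideanSpace ℝ (Fin n)) M] [IsManifold (𝓡 n) ∞ M]
    {F : Type*} [NormedAddCommGroup F] [NormedSpace ℝ F] [FiniteDimensional ℝ F]
    {E : M → Type*} [TopologicalSpace (TotalSpace F E)] [∀ m, AddCommGroup (E m)]
    [∀ m, Module ℝ (E m)] [∀ m, TopologicalSpace (E m)] [FiberBundle F E] [VectorBundle ℝ F E]
    [ContMDiffVectorBundle ∞ F E (𝓡 n)]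
    (L : ∀ m : M, Submodule ℝ (OmniLie.OmniFiber n F E m))
    (hsub : OmniLie.IsSmoothBundle n (A := fun m => L m) (OmniLie.subSections L))
    (hiso : OmniLie.IsIsotropic L) (hinv : OmniLie.IsInvolutive L) :
    OmniLie.IsLieAlgebroid n (A := fun m => L m) (OmniLie.subSections L)
      (fun s t => hinv.bracket s t)
      (fun m => (OmniLie.gaugeAnchor m).comp (OmniLie.rhoRestrict L m)) ∧
    OmniLie.IsRepresentation (A := fun m => L m) (OmniLie.subSections L)
      (fun s t => hinv.bracket s t)
      (fun m => (OmniLie.gaugeAnchor m).comp (OmniLie.rhoRestrict L m))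
      (OmniLie.rhoRestrict L) where
  left :=
    { isSmoothBundle := hsub
      anchor_smooth := fun s => s.2.1.1
      add_left := hinv.bracket.map_add₂
      smul_left := hinv.bracket.map_smul₂
      add_right := fun s => map_add (hinv.bracket s)
      smul_right := fun r s => map_smul (hinv.bracket s) r
      alternating := hinv.bracket_isAlt hiso
      jacobi := OmniLie.jacobi_of_isAlt_of_leibniz (R := ℝ) (A := OmniLie.subSections L)
        (hinv.bracket_isAlt hiso) hinv.bracket_leibniz
      leibniz := fun f s t m => Subtype.ext <| congrFun (congrArg Subtype.val <|
        OmniLie.dorfman_omniSmul (OmniLie.inclSection s) (OmniLie.inclSection t) f) m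
      anchor_bracket := fun _ _ _ => rfl }
  right :=
    { smooth := fun s => s.2.1
      anchor := fun _ _ => rfl
      map_bracket := fun _ _ _ => rfl }

theorem mainTheorem5 {n : ℕ} {M : Type*} [TopologicalSpace M] [T2Space M]
    [ChartedSpace (EuclideanSpace ℝ (Fin n)) M] [IsManifold (𝓡 n) ∞ M]
    {F : Type*} [NormedAddCommGroup F] [NormedSpace ℝ F] [FiniteDimensional ℝ F]
    {E : M → Type*} [TopologicalSpace (TotalSpace F E)] [∀ m, AddCommGroup (E m)]
    [∀ m, Module ℝ (E m)] [∀ m, TopologicalSpace (E m)] [FiberBundle F E] [VectorBundle ℝ F E]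
    [ContMDiffVectorBundle ∞ F E (𝓡 n)]
    (L : ∀ m : M, Submodule ℝ (OmniLie.OmniFiber n F E m)) (hL : OmniLie.IsDirac L) :
    OmniLie.IsLieAlgebroid n (A := fun m => L m) (OmniLie.subSections L)
      (OmniLie.restrictedBracket hL)
      (fun m => (OmniLie.gaugeAnchor m).comp (OmniLie.rhoRestrict L m)) ∧
    OmniLie.IsRepresentation (A := fun m => L m) (OmniLie.subSections L)
      (OmniLie.restrictedBracket hL)
      (fun m => (OmniLie.gaugeAnchor m).comp (OmniLie.rhoRestrict L m))
      (OmniLie.rhoRestrict L) :=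
  mainTheorem5_general L hL.isSubbundle (fun m => (hL.maximalIsotropic m).1) hL.closed
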